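/- **Setting.** Let $[z]$ be a nonzero entire function on $\mathbb{C}$ with $[\beta\pm\gamma][z\pm\alpha]+[\gamma\pm\alpha][z\pm\beta]+[\alpha\pm\beta][z\pm\gamma]=0$ for all $z,\alpha,\beta,\gamma\in\mathbb{C}$, where $[x\pm y]=[x+y][x-y]$. Let $V=\mathbb{C}^8$ with canonical basis $v_0,\dots,v_7$ and symmetric bilinear form $\langle v_i,v_j\rangle=\delta_{ij}$; put $\phi=(\tfrac12,\dots,\tfrac12)$, $P=Q(E_8)=\{a\in\mathbb{Z}^8\cup(\phi+\mathbb{Z}^8)\mid \langle\phi,a\rangle\in\mathbb{Z}\}$, and let $W(E_8)\subset GL(V)$ be generated by the reflections in the roots $\alpha\in P$, $\langle\alpha,\alpha\rangle=2$. A set $\{\pm a,\pm b,\pm c\}\subset V$ is a $C_3$-frame if $a,b,c$ are orthonormal, $a\pm b$, $b\pm c$, $c\pm a\in P$ and $2a,2b,2c\in P$. A function $\tau$ on a set $D\subseteq V$ with $D+P\delta=D$ is an ORG $\tau$-function if $$[\langle b\pm c,x\rangle]\,\tau(x\pm a\delta)+[\langle c\pm a,x\rangle]\,\tau(x\pm b\delta)+[\langle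 a\pm b,x\rangle]\,\tau(x\pm c\delta)=0$$ for all $C_3$-frames and all $x\in V$ with $x+a\delta\in D$, where $\tau(x\pm v)=\tau(x+v)\tau(x-v)$. Let $\mathfrak{h}=\bigoplus_{i=0}^{9}\mathbb{C}e_i$ with $\langle e_0,e_0\rangle=-1$, $\langle e_j,e_j\rangle=1$ for $1\le j\le 9$, and $\langle e_i,e_j\rangle=0$ for $i\ne j$ (so $\bigoplus\mathbb{Z}e_i$ is the Picard lattice of $\mathbb{P}^2$ blown up at nine points, with $-1$ times the intersection form). Let $c=3e_0-e_1-\cdots-e_9$, $d=-e_9-\tfrac12c$, $\mathfrak{h}_\kappa=\{h\mid\langle c,h\rangle=\kappa\}$, $e_{jk}=e_j-e_k$, $e_{jkl}=e_0-e_j-e_k-e_l$. Let $W(E_8^{(1)})=\langle s_0,\dots,s_8\rangle\subset GL(\mathfrak{h})$ be generated by the reflections in $\alpha_0=e_0-e_1-e_2-e_3$, $\alpha_j=e_j-e_{j+1}$ $(1\le j\le 8)$, and let $M=W(E_8^{(1)})e_9$. Identify $V$ with the orthogonal complement of $\mathbb{C}c\oplus\mathbb{C}d$ through $v_j=e_j-\tfrac12(e_0-e_9)+\tfrac12c$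 $(1\le j\le 8)$, $v_0=-v_8$. Let $\pi:\mathfrak{h}\to V$ be the orthogonal projection, and let $W(E_8)$ act on $\mathfrak{h}=V\oplus\mathbb{C}c\oplus\mathbb{C}d$ fixing $c$ and $d$. For $\alpha\in\mathfrak{h}_0$ let $T_\alpha(h)=h+\langle c,h\rangle\alpha-(\tfrac12\langle\alpha,\alpha\rangle\langle c,h\rangle+\langle\alpha,h\rangle)c$; it depends only on $\pi(\alpha)$, and $W(E_8^{(1)})=T(P)\rtimes W(E_8)\subset T(\tfrac12P)\rtimes W(E_8)$. For $\alpha\in\mathfrak{h}_0$ let $\sigma_\alpha=[\langle\alpha,\cdot\rangle]$, a function on $\mathfrak{h}/\mathbb{C}c$. Let a $W(E_8^{(1)})$-set $Y$, a map $\gamma:Y\to\mathfrak{h}/\mathbb{C}c$ and a $W(E_8^{(1)})$-stable subset $S\subseteq Y$ be given. A family of functions $\tau_\Lambda$ $(\Lambda\in M)$ on $S$ is a *system of lattice $\tau$-functions* if $w.\tau_\Lambda=\tau_{w.\Lambda}$ for all $w\in W(E_8^{(1)})$, $\Lambda\in M$, where $(w.\varphi)(y)=\varphi(w^{-1}.y)$,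 and on $S$ (the functions $\sigma$ being composed with $\gamma$) $$\sigma_{e_{jk}}\sigma_{e_{jkl}}\tau_{e_i}\tau_{e_0-e_i-e_l}+\sigma_{e_{ki}}\sigma_{e_{kil}}\tau_{e_j}\tau_{e_0-e_j-e_l}+\sigma_{e_{ij}}\sigma_{e_{ijl}}\tau_{e_k}\tau_{e_0-e_k-e_l}=0$$ for all mutually distinct $i,j,k,l\in\{1,\dots,9\}$. For a $T(\tfrac12P)\rtimes W(E_8)$-set $X$ let this group act on $\widetilde X=W(E_8)\times X$ by $T_\alpha w.(w',x)=(ww',T_\alpha w.x)$, and for $U\subseteq X$ put $\widetilde U=\{(w,x)\mid x\in w.U\}\subseteq\widetilde X$. **Theorem.** (1) Let $\gamma:X\to\mathfrak{h}/\mathbb{C}c$ be a $T(\tfrac12P)\rtimes W(E_8)$-equivariant map, $U\subseteq X$ a $T(P)$-stable subset and $\tau$ a function on $U$; put $\widetilde\tau(w,x)=\tau(w^{-1}.x)$ on $\widetilde U$. Then $\tau$ satisfies $$\sigma_{a_1\pm a_2}\,T_{a_0}.\tau\,T_{a_0}^{-1}.\tau+\sigma_{a_2\pm a_0}\,T_{a_1}.\tau\,T_{a_1}^{-1}.\tau+\sigma_{a_0\pm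 a_1}\,T_{a_2}.\tau\,T_{a_2}^{-1}.\tau=0$$ on $T_{a_0}.U$ for all $C_3$-frames $\{\pm a_0,\pm a_1,\pm a_2\}$, where $\sigma_{a\pm b}=\sigma_{a+b}\sigma_{a-b}$, if and only if the functions $\widetilde\tau_\Lambda=T_{\Lambda-e_9}^{-1}.\widetilde\tau$ $(\Lambda\in M)$ form a system of lattice $\tau$-functions on $\widetilde U$ (with respect to $(w,x)\mapsto\gamma(x)$). (2) Let $\kappa\in\mathbb{C}^\ast$ with $[n\kappa]\ne0$ for all nonzero integers $n$. Let $D\subseteq V$ be $W(E_8)$-stable with $D+P\kappa=D$, and let $\tau$ be an ORG $\tau$-function on $D$ with $\delta=\kappa$. Let $U=\{h\in\mathfrak{h}_\kappa\mid\pi(h)\in D\}$ and $\widetilde U=\{(w,h)\mid w\in W(E_8),\ h\in w.U\}$. Then the functions $$\widetilde\tau_\Lambda(w,h)=\tau\big(w^{-1}.(x+\kappa\alpha)\big),\qquad x=\pi(h),\quad \alpha=\pi(\Lambda-e_9)\quad(\Lambda\in M)$$ form a system of lattice $\tau$-functions on $\widetilde U$ (with respect to the map $(w,h)\mapsto h \bmod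 \mathbb{C}c$). -/

import Mathlib

namespace E8Tau

/-! ## The lattice `P = Q(E_8)` in `V = ℂ^8`, its Weyl group, and `C_3`-frames -/

/-- The space `V = ℂ^8`, with canonical basis `v_0, …, v_7`. -/
abbrev V : Type := Fin 8 → ℂ

/-- The scalar product on `V` (symmetric and bilinear) with `⟨v_i, v_j⟩ = δ_{ij}`. -/
def ipV : LinearMap.BilinForm ℂ V :=
  LinearMap.mk₂ ℂ (fun x y => ∑ j, x j * y j)
    (fun x x' y => by simp [add_mul, Finset.sum_add_distrib])
    (fun c x y => by simp [mul_assoc, Finset.mul_sum])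
    (fun x y y' => by simp [mul_add, Finset.sum_add_distrib])
    (fun c x y => by simp [mul_left_comm, Finset.mul_sum])

/-- `φ = (1/2, …, 1/2)`, the highest root of `E_8`. -/
noncomputable def phi : V := fun _ => 1 / 2

/-- The root lattice `P = Q(E_8) = {a ∈ ℤ^8 ∪ (φ + ℤ^8) | ⟨φ, a⟩ ∈ ℤ}`. -/
def P : Set V :=
  {a | ((∀ j, ∃ n : ℤ, a j = n) ∨ (∀ j, ∃ n : ℤ, a j = phi j + n)) ∧ ∃ n : ℤ, ipV phi a = n}

/-- The root system `Δ(E_8)`. -/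
def Delta : Set V := {α | α ∈ P ∧ ipV α α = 2}

/-- The reflection `v ↦ v - ⟨α, v⟩ α` for a vector `α` with `⟨α, α⟩ = 2` (so that `α^∨ = α`). -/
noncomputable def reflV (α : V) (hα : ipV α α = 2) : V ≃ₗ[ℂ] V :=
  Module.reflection (x := α) (f := ipV α) hα

/-- The Weyl group `W(E_8)`, generated by the reflections with respect to the roots. -/
def WE8 : Subgroup (V ≃ₗ[ℂ] V) :=
  Subgroup.closure {g | ∃ (α : V) (hα : α ∈ Delta), g = reflV α hα.2}

/-- `{±a, ±b, ±c}` is a `C_3`-frame relative to `P`. -/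
structure IsC3Frame (a b c : V) : Prop where
  aa : ipV a a = 1
  bb : ipV b b = 1
  cc : ipV c c = 1
  ab : ipV a b = 0
  bc : ipV b c = 0
  ca : ipV c a = 0
  ab_add : a + b ∈ P
  ab_sub : a - b ∈ P
  bc_add : b + c ∈ P
  bc_sub : b - c ∈ P
  ca_add : c + a ∈ P
  ca_sub : c - a ∈ P
  two_a : (2 : ℂ) • a ∈ P
  two_b : (2 : ℂ) • b ∈ P
  two_c : (2 : ℂ) • c ∈ P

/-! ## ORG tau-functions -/

/-- A nonzero entire function `[z]` with
`[β±γ][z±α] + [γ±α][z±β] + [α±β][z±γ] = 0`, where `[x±y] = [x+y][x-y]`. -/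
structure IsBracket (br : ℂ → ℂ) : Prop where
  entire : Differentiable ℂ br
  nonzero : ∃ z, br z ≠ 0
  three_term : ∀ z α β γ : ℂ,
    br (β + γ) * br (β - γ) * (br (z + α) * br (z - α)) +
    br (γ + α) * br (γ - α) * (br (z + β) * br (z - β)) +
    br (α + β) * br (α - β) * (br (z + γ) * br (z - γ)) = 0

/-- `τ` is an ORG tau-function on `D` with step `δ`: the non-autonomous Hirota equations
`[⟨b±c,x⟩]τ(x±aδ) + [⟨c±a,x⟩]τ(x±bδ) + [⟨a±b,x⟩]τ(x±cδ) = 0` hold for all `C_3`-frames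
and all `x` for which one (hence, if `D + Pδ = D`, each) of the six points `x±aδ`, `x±bδ`, `x±cδ`
is in `D`. Only the values of `τ` on `D` matter. -/
def IsORG (br : ℂ → ℂ) (δ : ℂ) (D : Set V) (τ : V → ℂ) : Prop :=
  ∀ a b c : V, IsC3Frame a b c → ∀ x : V, x + δ • a ∈ D →
    br (ipV (b + c) x) * br (ipV (b - c) x) * (τ (x + δ • a) * τ (x - δ • a)) +
    br (ipV (c + a) x) * br (ipV (c - a) x) * (τ (x + δ • b) * τ (x - δ • b)) +
    br (ipV (a + b) x) * br (ipV (a - b) x) * (τ (x + δ • c) * τ (x - δ • c)) = 0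

/-! ## The Picard lattice and the affine Weyl group -/

/-- The space `𝔥 = ℂe_0 ⊕ ⋯ ⊕ ℂe_9`. -/
abbrev H : Type := Fin 10 → ℂ

/-- The scalar product on `𝔥`: `⟨e_0,e_0⟩ = -1`, `⟨e_j,e_j⟩ = 1` for `j = 1, …, 9`, and
`⟨e_i,e_j⟩ = 0` for `i ≠ j`. -/
def ipH : LinearMap.BilinForm ℂ H :=
  LinearMap.mk₂ ℂ (fun x y => -(x 0 * y 0) + ∑ j : Fin 9, x j.succ * y j.succ)
    (fun x x' y => by simp [add_mul, Finset.sum_add_distrib]; ring)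
    (fun c x y => by simp [mul_assoc, Finset.mul_sum, mul_add])
    (fun x y y' => by simp [mul_add, Finset.sum_add_distrib]; ring)
    (fun c x y => by simp [mul_left_comm, Finset.mul_sum, mul_add])

theorem ipH_apply (x y : H) : ipH x y = -(x 0 * y 0) + ∑ j : Fin 9, x j.succ * y j.succ := rfl

/-- The basis `e_0, …, e_9` of `𝔥`. -/
def e (i : Fin 10) : H := Pi.single i 1

/-- `e_1, …, e_9`, the classes of the nine exceptional divisors, indexed by `Fin 9`. -/
def ex (i : Fin 9) : H := e i.succ

/-- `c = 3e_0 - e_1 - ⋯ - e_9`. -/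
def c : H := (3 : ℂ) • e 0 - ∑ j, ex j

/-- `d = -e_9 - c/2`. -/
noncomputable def d : H := -e 9 - (1 / 2 : ℂ) • c

/-- The simple roots `α_0 = e_0 - e_1 - e_2 - e_3` and `α_j = e_j - e_{j+1}`, `j = 1, …, 8`. -/
def simpleRoot : Fin 9 → H :=
  Fin.cases (e 0 - e 1 - e 2 - e 3) (fun j : Fin 8 => ex j.castSucc - ex j.succ)

theorem e_apply (i j : Fin 10) : e i j = if j = i then 1 else 0 := by
  simp [e, Pi.single_apply]

theorem ex_apply (i : Fin 9) (j : Fin 10) : ex i j = if j = i.succ then 1 else 0 := e_apply _ _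

theorem c_zero : c 0 = 3 := by
  simp [c, e_apply, ex_apply, (Fin.succ_ne_zero _).symm]

theorem c_succ (j : Fin 9) : c j.succ = -1 := by
  simp [c, e_apply, ex_apply]

theorem ipH_ex (x : H) (j : Fin 9) : ipH x (ex j) = x j.succ := by
  simp [ipH_apply, ex_apply, (Fin.succ_ne_zero _).symm]

theorem ipH_e_zero (x : H) : ipH x (e 0) = -x 0 := by
  simp [ipH_apply, e_apply]

theorem ipH_comm (x y : H) : ipH x y = ipH y x := by
  simp [ipH_apply, mul_comm]

theorem ipH_simpleRoot (j : Fin 9) : ipH (simpleRoot j) (simpleRoot j) = 2 := by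
  refine Fin.cases ?_ (fun j => ?_) j
  · simp only [simpleRoot, Fin.cases_zero, show (e 1) = ex 0 from rfl, show (e 2) = ex 1 from rfl,
      show (e 3) = ex 2 from rfl]
    simp [map_sub, LinearMap.sub_apply, ipH_ex, ipH_e_zero, e_apply, ex_apply]
    norm_num
  · have h : j.castSucc ≠ j.succ := by simp [Fin.ext_iff]
    simp [simpleRoot, Fin.cases_succ, map_sub, LinearMap.sub_apply, ipH_ex, ex_apply, h, h.symm]
    norm_num

/-- The simple reflections `s_j(h) = h - ⟨α_j, h⟩ α_j` (note `α_j^∨ = α_j`), `j = 0, …, 8`. -/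
noncomputable def s (j : Fin 9) : H ≃ₗ[ℂ] H :=
  Module.reflection (x := simpleRoot j) (f := ipH (simpleRoot j)) (ipH_simpleRoot j)

/-- The affine Weyl group `W(E_8^{(1)}) = ⟨s_0, …, s_8⟩`, as a group of linear maps of `𝔥`. -/
def Waff : Subgroup (H ≃ₗ[ℂ] H) := Subgroup.closure (Set.range s)

/-- The orbit `M = W(E_8^{(1)}) e_9`. -/
def M : Set H := MulAction.orbit Waff (e 9)

/-- The action of `W(E_8^{(1)})` on the orbit `M`. -/
noncomputable instance : MulAction Waff M := inferInstanceAs (MulAction Waff (MulAction.orbit Waff (e 9)))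

/-- `𝔥_0 = {h | ⟨c, h⟩ = 0}`. -/
def H0 : Submodule ℂ H := LinearMap.ker (ipH c)

theorem mem_H0 (x : H) : x ∈ H0 ↔ ipH c x = 0 := Iff.rfl

theorem ipH_c_c : ipH c c = 0 := by
  simp [ipH_apply, c_zero, c_succ]; norm_num

theorem c_mem_H0 : c ∈ H0 := ipH_c_c

theorem ipH_c_simpleRoot (j : Fin 9) : ipH c (simpleRoot j) = 0 := by
  refine Fin.cases ?_ (fun j => ?_) j
  · simp only [simpleRoot, Fin.cases_zero, show (e 1) = ex 0 from rfl, show (e 2) = ex 1 from rfl,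
      show (e 3) = ex 2 from rfl, map_sub, ipH_ex, ipH_e_zero, c_succ, c_zero]
    norm_num
  · simp only [simpleRoot, Fin.cases_succ, map_sub, ipH_ex, c_succ]
    norm_num

/-- The underlying map of the Kac translation `T_α`, `α ∈ 𝔥_0`:
`T_α(h) = h + ⟨c,h⟩α - (⟨α,α⟩⟨c,h⟩/2 + ⟨α,h⟩)c`. -/
noncomputable def kacLin (α : H) : H →ₗ[ℂ] H :=
  LinearMap.id + (ipH c).smulRight α
    - (((1 / 2 : ℂ) * ipH α α) • ipH c + ipH α).smulRight c

theorem kacLin_apply (α h : H) :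
    kacLin α h = h + ipH c h • α - ((1 / 2 : ℂ) * ipH α α * ipH c h + ipH α h) • c := by
  simp [kacLin]

theorem kacLin_kacLin_neg (α : H) (hα : α ∈ H0) (h : H) : kacLin α (kacLin (-α) h) = h := by
  have h1 : ipH c α = 0 := hα
  have h2 : ipH α c = 0 := by rw [ipH_comm]; exact hα
  simp only [kacLin_apply, map_add, map_sub, map_smul, map_neg, LinearMap.neg_apply, h1, h2,
    ipH_c_c]
  module

/-- The Kac translation `T_α`, `α ∈ 𝔥_0`. -/
noncomputable def kac (α : H0) : H ≃ₗ[ℂ] H :=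
  LinearEquiv.ofLinearMap (kacLin α) (kacLin (-α))
    (LinearMap.ext fun h => kacLin_kacLin_neg α α.2 h)
    (LinearMap.ext fun h => by
      simpa using kacLin_kacLin_neg (-α) (H0.neg_mem α.2) h)

theorem kac_apply (α : H0) (h : H) : kac α h = kacLin α h := rfl

/-! ## The identification of `V` with a subspace of `𝔥` -/

/-- `v_j = e_j - (e_0 - e_9)/2 + c/2` for `j = 1, …, 8`; the argument of type `Fin 9` is `j - 1`. -/
noncomputable def vAux (j : Fin 9) : H := ex j - (1 / 2 : ℂ) • (e 0 - ex 8) + (1 / 2 : ℂ) • c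

/-- The orthonormal vectors `v_0 = -v_8` and `v_1, …, v_7`. -/
noncomputable def v : Fin 8 → H :=
  Fin.cases (-vAux 7) (fun j : Fin 7 => vAux j.castSucc.castSucc)

/-- The embedding `V → 𝔥`, `x ↦ ∑ x_j v_j`. -/
noncomputable def iota : V →ₗ[ℂ] H := Fintype.linearCombination ℂ v

/-- The orthogonal projection `π : 𝔥 → V`, in the coordinates `x_j = ⟨v_j, ·⟩`. -/
noncomputable def proj : H →ₗ[ℂ] V := LinearMap.pi fun j => ipH (v j)

theorem iota_apply (x : V) : iota x = ∑ j, x j • v j := by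
  simp [iota, Fintype.linearCombination_apply]

theorem proj_apply (h : H) (j : Fin 8) : proj h j = ipH (v j) h := rfl

theorem ipH_vAux (j : Fin 9) (h : H) :
    ipH (vAux j) h = h j.succ + (1 / 2 : ℂ) * (h 0 + h 9) + (1 / 2 : ℂ) * ipH c h := by
  rw [ipH_comm, vAux]
  simp only [map_add, map_sub, map_smul, ipH_ex, ipH_e_zero, ipH_comm h c, smul_eq_mul]
  rw [show (8 : Fin 9).succ = 9 from rfl]
  ring

theorem ipH_vAux_c (j : Fin 9) : ipH (vAux j) c = 0 := by
  rw [ipH_vAux, ipH_c_c, c_succ, c_zero, show (9 : Fin 10) = (8 : Fin 9).succ from rfl, c_succ]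
  norm_num

theorem ipH_vAux_vAux (i j : Fin 9) (hi : i ≠ 8) (hj : j ≠ 8) :
    ipH (vAux i) (vAux j) = if i = j then 1 else 0 := by
  rw [ipH_vAux, ipH_comm, ipH_vAux_c, show (9 : Fin 10) = (8 : Fin 9).succ from rfl]
  simp only [vAux, Pi.add_apply, Pi.sub_apply, Pi.smul_apply, c_succ, c_zero, ex_apply, e_apply,
    smul_eq_mul, Fin.succ_inj, Fin.succ_ne_zero, (Fin.succ_ne_zero _).symm, hj.symm, if_true,
    if_false]
  by_cases hij : j = i
  · subst hij; simp [hi]; norm_num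
  · have hij' : ¬ i = j := fun h => hij h.symm
    simp [hi, hij']; norm_num

theorem ipH_v_c (j : Fin 8) : ipH (v j) c = 0 := by
  refine Fin.cases ?_ (fun j => ?_) j <;> simp [v, ipH_vAux_c]

theorem ipH_v_v (i j : Fin 8) : ipH (v i) (v j) = if i = j then 1 else 0 := by
  have h8 (j : Fin 7) : j.castSucc.castSucc ≠ (8 : Fin 9) := by
    intro h; have := congrArg Fin.val h; simp at this; omega
  have h7 (j : Fin 7) : j.castSucc.castSucc ≠ (7 : Fin 9) := by
    intro h; have := congrArg Fin.val h; simp at this; omega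
  refine Fin.cases ?_ (fun i => ?_) i <;> refine Fin.cases ?_ (fun j => ?_) j
  · simp [v, ipH_vAux_vAux]
  · simp [v, ipH_vAux_vAux, h8, (h7 _).symm, (Fin.succ_ne_zero _).symm]
  · simp [v, ipH_vAux_vAux, h7, h8]
  · simp [v, ipH_vAux_vAux, h8]

theorem iota_mem_H0 (x : V) : iota x ∈ H0 := by
  rw [mem_H0, iota_apply]
  simp [ipH_comm c, ipH_v_c]

theorem proj_c : proj c = 0 := by
  ext j; simp [proj_apply, ipH_v_c]

theorem proj_iota (x : V) : proj (iota x) = x := by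
  ext j; simp [proj_apply, iota_apply, ipH_v_v]

/-- The embedding `V → 𝔥`, with values in `𝔥_0`. -/
noncomputable def iota0 : V →ₗ[ℂ] H0 := iota.codRestrict H0 iota_mem_H0

theorem iota0_coe (x : V) : (iota0 x : H) = iota x := rfl

/-- The extension of a linear map `g` of `V` to `𝔥 = V ⊕ ℂc ⊕ ℂd` that fixes `c` and `d`, that is,
`h ↦ ι(g(π h)) + (h - ι(π h))`. -/
noncomputable def extLin (g : V ≃ₗ[ℂ] V) : H →ₗ[ℂ] H :=
  iota ∘ₗ g.toLinearMap ∘ₗ proj + (LinearMap.id - iota ∘ₗ proj)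

theorem extLin_apply (g : V ≃ₗ[ℂ] V) (h : H) :
    extLin g h = iota (g (proj h)) + (h - iota (proj h)) := rfl

theorem extLin_extLin (g g' : V ≃ₗ[ℂ] V) (h : H) : extLin g (extLin g' h) = extLin (g * g') h := by
  simp [extLin_apply, proj_iota]

theorem extLin_one (h : H) : extLin 1 h = h := by
  simp [extLin_apply]

/-- The action of a linear automorphism of `V` on `𝔥`. -/
noncomputable def ext (g : V ≃ₗ[ℂ] V) : H ≃ₗ[ℂ] H :=
  LinearEquiv.ofLinearMap (extLin g) (extLin g⁻¹)
    (LinearMap.ext fun h => by simp [extLin_extLin, extLin_one])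
    (LinearMap.ext fun h => by simp [extLin_extLin, extLin_one])

theorem ext_apply (g : V ≃ₗ[ℂ] V) (h : H) :
    ext g h = iota (g (proj h)) + (h - iota (proj h)) := rfl

/-! ## The extended group `T(Q(E_8)/2) ⋊ W(E_8)` -/

/-- The group `T(Q(E_8)/2) ⋊ W(E_8)` of linear maps of `𝔥`. -/
def Wext : Subgroup (H ≃ₗ[ℂ] H) :=
  Subgroup.closure ({g | ∃ a : V, (2 : ℂ) • a ∈ P ∧ g = kac (iota0 a)} ∪ {g | ∃ w ∈ WE8, g = ext w})

/-- `T_a` as an element of the extended group, for `a ∈ Q(E_8)/2`. -/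
noncomputable def transl (a : V) (ha : (2 : ℂ) • a ∈ P) : Wext :=
  ⟨kac (iota0 a), Subgroup.subset_closure (Or.inl ⟨a, ha, rfl⟩)⟩

/-- `w ∈ W(E_8)` as an element of the extended group. -/
noncomputable def emb (w : WE8) : Wext :=
  ⟨ext w, Subgroup.subset_closure (Or.inr ⟨w, w.2, rfl⟩)⟩

/-- The linear automorphisms of `𝔥` that fix `c` and the linear form `⟨c, ·⟩`. -/
def Stab : Subgroup (H ≃ₗ[ℂ] H) where
  carrier := {g | g c = c ∧ ∀ h, ipH c (g h) = ipH c h}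
  mul_mem' {g g'} hg hg' := ⟨by simp [hg.1, hg'.1], fun h => by simp [hg.2, hg'.2]⟩
  one_mem' := ⟨rfl, fun _ => rfl⟩
  inv_mem' {g} hg := by
    refine ⟨?_, fun h => ?_⟩
    · have : g⁻¹ (g c) = g⁻¹ c := by rw [hg.1]
      rw [← LinearEquiv.mul_apply, inv_mul_cancel] at this
      exact this.symm
    · have := hg.2 (g⁻¹ h)
      rw [← LinearEquiv.mul_apply, mul_inv_cancel] at this
      exact this.symm

theorem s_apply (j : Fin 9) (h : H) : s j h = h - ipH (simpleRoot j) h • simpleRoot j := by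
  simp [s, Module.reflection_apply]

theorem reflV_apply (α : V) (hα : ipV α α = 2) (x : V) : reflV α hα x = x - ipV α x • α := by
  simp [reflV, Module.reflection_apply]

theorem Wext_le_Stab : Wext ≤ Stab := by
  rw [Wext, Subgroup.closure_le]
  rintro g (⟨a, -, rfl⟩ | ⟨w, -, rfl⟩)
  · have h1 : ipH c (iota a) = 0 := iota_mem_H0 a
    have h2 : ipH (iota a) c = 0 := by rw [ipH_comm]; exact h1
    refine ⟨?_, fun h => ?_⟩
    · simp [kac_apply, kacLin_apply, iota0, ipH_c_c, h2]
    · simp [kac_apply, kacLin_apply, iota0, ipH_c_c, h1]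
  · have h1 (x : V) : ipH c (iota x) = 0 := iota_mem_H0 x
    refine ⟨?_, fun h => ?_⟩
    · simp [ext_apply, proj_c]
    · simp [ext_apply, h1]

theorem Waff_le_Stab : Waff ≤ Stab := by
  rw [Waff, Subgroup.closure_le]
  rintro g ⟨j, rfl⟩
  refine ⟨?_, fun h => ?_⟩
  · simp [s_apply, ipH_comm _ c, ipH_c_simpleRoot]
  · simp [s_apply, ipH_c_simpleRoot]

/-- An element of `𝔥_0` is the sum of its classical part and a multiple of `c`. -/
theorem H0_decomp (h : H) (hh : h ∈ H0) : h = iota (proj h) - h 9 • c := by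
  have h1 : ipH c h = 0 := hh
  have h2 := h1
  rw [ipH_apply, c_zero] at h2
  simp only [c_succ] at h2
  have hv (j : Fin 9) : ipH (vAux j) h = h j.succ + (1 / 2 : ℂ) * (h 0 + h 9) := by
    rw [ipH_vAux, h1]; ring
  have h9 : (9 : Fin 10) = (8 : Fin 9).succ := rfl
  rw [iota_apply]
  simp only [proj_apply, Fin.sum_univ_succ (n := 7), v, Fin.cases_zero, Fin.cases_succ,
    map_neg, LinearMap.neg_apply, hv]
  simp only [Fin.sum_univ_succ, Fin.sum_univ_zero] at h2 ⊢
  ext i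
  fin_cases i <;> simp [vAux, c, e_apply, ex_apply, Fin.sum_univ_succ] at h2 ⊢ <;>
    first | linear_combination h2 | linear_combination (-1 / 2 : ℂ) * h2

theorem ipV_apply (x y : V) : ipV x y = ∑ j, x j * y j := rfl

theorem ipH_iota_left (x : V) (h : H) : ipH (iota x) h = ipV x (proj h) := by
  simp [iota_apply, ipV_apply, proj_apply]

theorem ipH_iota_iota (x y : V) : ipH (iota x) (iota y) = ipV x y := by
  rw [ipH_iota_left, proj_iota]

/-- The Picard lattice `L = ℤe_0 ⊕ ⋯ ⊕ ℤe_9`. -/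
def L : AddSubgroup H where
  carrier := {h | ∀ j, h j ∈ (Int.castRingHom ℂ).range}
  add_mem' hx hy j := add_mem (hx j) (hy j)
  zero_mem' _ := zero_mem _
  neg_mem' hx j := neg_mem (hx j)

theorem ipH_mem_of_mem_L {x y : H} (hx : x ∈ L) (hy : y ∈ L) :
    ipH x y ∈ (Int.castRingHom ℂ).range := by
  rw [ipH_apply]
  exact add_mem (neg_mem (mul_mem (hx _) (hy _))) (sum_mem fun j _ => mul_mem (hx _) (hy _))

theorem smul_mem_L {z : ℂ} {x : H} (hz : z ∈ (Int.castRingHom ℂ).range) (hx : x ∈ L) :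
    z • x ∈ L := fun j => mul_mem hz (hx j)

theorem e_mem_L (i : Fin 10) : e i ∈ L := fun j => by
  rw [e_apply]; split_ifs
  · exact one_mem _
  · exact zero_mem _

theorem simpleRoot_mem_L (j : Fin 9) : simpleRoot j ∈ L := by
  refine Fin.cases ?_ (fun j => ?_) j
  · exact sub_mem (sub_mem (sub_mem (e_mem_L _) (e_mem_L _)) (e_mem_L _)) (e_mem_L _)
  · exact sub_mem (e_mem_L _) (e_mem_L _)

/-- `Q(E_8^{(1)}) = L ∩ 𝔥_0` projects to `Q(E_8) = P`. -/
theorem proj_mem_P {h : H} (hL : h ∈ L) (h0 : h ∈ H0) : proj h ∈ P := by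
  have h1 : ipH c h = 0 := h0
  have hn : ∀ j, ∃ n : ℤ, h j = n := fun j => by
    obtain ⟨n, hn⟩ := hL j; exact ⟨n, by simpa using hn.symm⟩
  choose n hn using hn
  have h2 := h1
  rw [ipH_apply, c_zero] at h2
  simp only [c_succ] at h2
  have hv (j : Fin 9) : ipH (vAux j) h = n j.succ + (1 / 2 : ℂ) * (n 0 + n 9) := by
    rw [ipH_vAux, h1, hn, hn, hn]; ring
  have hp0 : proj h 0 = -(n 8 + (1 / 2 : ℂ) * (n 0 + n 9)) := by
    rw [show (8 : Fin 10) = (7 : Fin 9).succ from rfl, ← hv 7]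
    simp [proj_apply, v]
  have hps (j : Fin 7) :
      proj h j.succ = n j.castSucc.castSucc.succ + (1 / 2 : ℂ) * (n 0 + n 9) := by
    simpa [proj_apply, v] using hv j.castSucc.castSucc
  constructor
  · rcases Int.even_or_odd' (n 0 + n 9) with ⟨m, hm | hm⟩
    · have hm' : (n 0 : ℂ) + n 9 = 2 * m := by exact_mod_cast hm
      left
      refine Fin.cases ⟨-(n 8 + m), ?_⟩ (fun j => ⟨n j.castSucc.castSucc.succ + m, ?_⟩)
      · rw [hp0, hm']; push_cast; ring
      · rw [hps, hm']; push_cast; ring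
    · have hm' : (n 0 : ℂ) + n 9 = 2 * m + 1 := by exact_mod_cast hm
      right
      refine Fin.cases ⟨-(n 8 + m + 1), ?_⟩ (fun j => ⟨n j.castSucc.castSucc.succ + m, ?_⟩)
      · rw [hp0, hm', phi]; push_cast; ring
      · rw [hps, hm', phi]; push_cast; ring
  · refine ⟨n 9 - n 8, ?_⟩
    rw [ipV_apply, Fin.sum_univ_succ]
    simp only [hp0, hps, phi, Fin.sum_univ_succ, Fin.sum_univ_zero, hn] at h2 ⊢
    simp at h2 ⊢
    linear_combination (-1 / 2 : ℂ) * h2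

theorem ipV_proj_proj (α : H) (h0 : α ∈ H0) : ipV (proj α) (proj α) = ipH α α := by
  have hci (x : V) : ipH c (iota x) = 0 := iota_mem_H0 x
  have hd := H0_decomp α h0
  generalize proj α = β at hd
  generalize α 9 = k at hd
  subst hd
  simp [hci, ipH_c_c, ipH_iota_left, proj_iota, proj_c]

/-- The reflection with respect to `β - kc` is `T_{kβ}` times the reflection with respect to `β`. -/
theorem kac_ext_reflV (β : V) (k : ℂ) (hβ : ipV β β = 2) (h : H) :
    kac (iota0 (k • β)) (ext (reflV β hβ) h) =
      h - ipH (iota β - k • c) h • (iota β - k • c) := by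
  have hci (x : V) : ipH c (iota x) = 0 := iota_mem_H0 x
  rw [kac_apply, kacLin_apply, iota0_coe]
  simp only [ext_apply, reflV_apply, map_add, map_sub, map_smul,
    hci, LinearMap.smul_apply, LinearMap.sub_apply, ipH_iota_left, hβ, smul_eq_mul, proj_iota]
  module

theorem Waff_le_Wext : Waff ≤ Wext := by
  rw [Waff, Subgroup.closure_le]
  rintro g ⟨j, rfl⟩
  have h0 : simpleRoot j ∈ H0 := ipH_c_simpleRoot j
  have hL := simpleRoot_mem_L j
  have hβ : ipV (proj (simpleRoot j)) (proj (simpleRoot j)) = 2 := by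
    rw [ipV_proj_proj _ h0, ipH_simpleRoot]
  have hk : (2 : ℂ) • (simpleRoot j 9 • proj (simpleRoot j)) ∈ P := by
    rw [← map_smul, ← map_smul]
    refine proj_mem_P (smul_mem_L ⟨2, by simp⟩ (smul_mem_L (hL 9) hL)) ?_
    exact H0.smul_mem _ (H0.smul_mem _ h0)
  have key : s j = (transl _ hk * emb ⟨reflV _ hβ, Subgroup.subset_closure
      ⟨_, ⟨proj_mem_P hL h0, hβ⟩, rfl⟩⟩ : Wext) := by
    refine LinearEquiv.ext fun h => ?_
    rw [s_apply]
    conv_lhs => rw [H0_decomp _ h0]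
    exact (kac_ext_reflV _ _ hβ h).symm
  rw [SetLike.mem_coe, key]
  exact Subtype.property _

/-- The linear part on `V` of an element of `Stab`. -/
noncomputable def finLin (g : H ≃ₗ[ℂ] H) : V →ₗ[ℂ] V := proj ∘ₗ g.toLinearMap ∘ₗ iota

theorem finLin_mul (g g' : H ≃ₗ[ℂ] H) (hg : g ∈ Stab) (hg' : g' ∈ Stab) (x : V) :
    finLin g (finLin g' x) = finLin (g * g') x := by
  have h0 : g' (iota x) ∈ H0 := by
    rw [mem_H0, hg'.2]; exact iota_mem_H0 x
  have hd := congrArg (fun h => proj (g h)) (H0_decomp _ h0)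
  simp only [map_sub, map_smul, hg.1, proj_c, smul_zero, sub_zero] at hd
  exact hd.symm

theorem finLin_one (x : V) : finLin 1 x = x := proj_iota x

theorem finLin_mul_inv (g : Stab) (x : V) : finLin g (finLin (g : H ≃ₗ[ℂ] H)⁻¹ x) = x := by
  rw [finLin_mul _ _ g.2 (inv_mem g.2), mul_inv_cancel, finLin_one]

theorem finLin_inv_mul (g : Stab) (x : V) : finLin (g : H ≃ₗ[ℂ] H)⁻¹ (finLin g x) = x := by
  rw [finLin_mul _ _ (inv_mem g.2) g.2, inv_mul_cancel, finLin_one]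

/-- The linear part on `V` of an element of `Stab`, as a linear automorphism. -/
noncomputable def finEquiv (g : Stab) : V ≃ₗ[ℂ] V :=
  LinearEquiv.ofLinearMap (finLin g) (finLin (g : H ≃ₗ[ℂ] H)⁻¹)
    (LinearMap.ext (finLin_mul_inv g)) (LinearMap.ext (finLin_inv_mul g))

theorem finEquiv_apply (g : Stab) (x : V) : finEquiv g x = finLin g x := rfl

/-- The homomorphism that takes an element of `Stab` to its linear part on `V`. -/
noncomputable def finStab : Stab →* (V ≃ₗ[ℂ] V) :=
  MonoidHom.mk' finEquiv fun g g' => LinearEquiv.ext fun x => by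
    rw [LinearEquiv.mul_apply, finEquiv_apply, finEquiv_apply, finEquiv_apply,
      finLin_mul _ _ g.2 g'.2, Subgroup.coe_mul]

theorem finStab_apply (g : Stab) (x : V) : finStab g x = proj ((g : H ≃ₗ[ℂ] H) (iota x)) := rfl

theorem finStab_kac (a : V) (h : kac (iota0 a) ∈ Stab) : finStab ⟨kac (iota0 a), h⟩ = 1 := by
  refine LinearEquiv.ext fun x => ?_
  have hci (x : V) : ipH c (iota x) = 0 := iota_mem_H0 x
  simp [finStab_apply, kac_apply, kacLin_apply, iota0, hci, proj_iota, proj_c]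

theorem finStab_ext (w : V ≃ₗ[ℂ] V) (h : ext w ∈ Stab) : finStab ⟨ext w, h⟩ = w := by
  refine LinearEquiv.ext fun x => ?_
  simp [finStab_apply, ext_apply, proj_iota]

theorem finStab_mem (g : Wext) : finStab (Subgroup.inclusion Wext_le_Stab g) ∈ WE8 := by
  obtain ⟨g, hg⟩ := g
  have : Wext ≤ (WE8.comap finStab).map Stab.subtype := by
    conv_lhs => rw [Wext]
    rw [Subgroup.closure_le]
    rintro g (⟨a, ha, rfl⟩ | ⟨w, hw, rfl⟩)
    · have hS : kac (iota0 a) ∈ Stab := Wext_le_Stab (transl a ha).2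
      refine ⟨⟨_, hS⟩, ?_, rfl⟩
      rw [SetLike.mem_coe, Subgroup.mem_comap, finStab_kac]
      exact one_mem _
    · have hS : ext w ∈ Stab := Wext_le_Stab (emb ⟨w, hw⟩).2
      refine ⟨⟨_, hS⟩, ?_, rfl⟩
      rw [SetLike.mem_coe, Subgroup.mem_comap, finStab_ext]
      exact hw
  obtain ⟨g', hg', rfl⟩ := this hg
  exact hg'

/-- The projection `T(Q(E_8)/2) ⋊ W(E_8) → W(E_8)`, `T_a w ↦ w`. -/
noncomputable def finPart : Wext →* WE8 :=
  (finStab.comp (Subgroup.inclusion Wext_le_Stab)).codRestrict WE8 finStab_mem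

theorem finPart_transl (a : V) (ha : (2 : ℂ) • a ∈ P) : finPart (transl a ha) = 1 :=
  Subtype.ext (finStab_kac a _)

theorem finPart_emb (w : WE8) : finPart (emb w) = w := Subtype.ext (finStab_ext w _)

theorem mem_L_of_Waff {g : H ≃ₗ[ℂ] H} (hg : g ∈ Waff) : ∀ h ∈ L, g h ∈ L := by
  induction hg using Subgroup.closure_induction'' with
  | mem g hg =>
    obtain ⟨j, rfl⟩ := hg
    intro h hh
    rw [s_apply]
    exact sub_mem hh (smul_mem_L (ipH_mem_of_mem_L (simpleRoot_mem_L j) hh) (simpleRoot_mem_L j))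
  | inv_mem g hg =>
    obtain ⟨j, rfl⟩ := hg
    intro h hh
    have : (s j)⁻¹ h = s j h := rfl
    rw [this, s_apply]
    exact sub_mem hh (smul_mem_L (ipH_mem_of_mem_L (simpleRoot_mem_L j) hh) (simpleRoot_mem_L j))
  | one => exact fun h hh => hh
  | mul g g' _ _ hg hg' => exact fun h hh => hg _ (hg' h hh)

theorem M_mem_L (Λ : M) : (Λ : H) ∈ L := by
  obtain ⟨_, g, rfl⟩ := Λ
  exact mem_L_of_Waff g.2 _ (e_mem_L 9)

theorem M_sub_mem_H0 (Λ : M) : (Λ : H) - e 9 ∈ H0 := by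
  obtain ⟨_, g, rfl⟩ := Λ
  have : ipH c ((g : H ≃ₗ[ℂ] H) (e 9)) = ipH c (e 9) := (Waff_le_Stab g.2).2 _
  rw [mem_H0, map_sub, sub_eq_zero]
  exact this

/-- `T_α = T_{α'}` if `α'` is the classical part of `α ∈ 𝔥_0`. -/
theorem kac_eq_kac_proj (α : H0) : kac α = kac (iota0 (proj α)) := by
  refine LinearEquiv.ext fun h => ?_
  have hci (x : V) : ipH c (iota x) = 0 := iota_mem_H0 x
  rw [kac_apply, kac_apply, kacLin_apply, kacLin_apply, iota0_coe, ipH_iota_left, proj_iota,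
    ipV_proj_proj _ α.2]
  have hd := H0_decomp α α.2
  have h1 : ipH (α : H) h = ipH (iota (proj α)) h - (α : H) 9 * ipH c h := by
    conv_lhs => rw [hd]
    simp
  rw [h1]
  conv_lhs => enter [1, 2]; rw [hd]
  module

/-- `T_{Λ - e_9}`, for `Λ ∈ M`, as an element of the extended group. -/
noncomputable def translM (Λ : M) : Wext :=
  ⟨kac ⟨(Λ : H) - e 9, M_sub_mem_H0 Λ⟩, by
    have h2 : (2 : ℂ) • proj ((Λ : H) - e 9) ∈ P := by
      rw [← map_smul]
      exact proj_mem_P (smul_mem_L ⟨2, by simp⟩ (sub_mem (M_mem_L Λ) (e_mem_L 9)))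
        (H0.smul_mem _ (M_sub_mem_H0 Λ))
    rw [kac_eq_kac_proj]
    exact (transl _ h2).2⟩

/-! ## The classes used in the bilinear equations -/

theorem s_mem_M (j : Fin 9) {h : H} (hh : h ∈ M) : s j h ∈ M := by
  obtain ⟨g, rfl⟩ := hh
  exact ⟨⟨s j, Subgroup.subset_closure ⟨j, rfl⟩⟩ * g, rfl⟩

theorem ex_mem_M (i : Fin 9) : ex i ∈ M := by
  induction i using Fin.reverseInduction with
  | last => exact MulAction.mem_orbit_self _
  | cast i ih =>
    have : s i.succ (ex i.succ) = ex i.castSucc := by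
      have h : i.castSucc ≠ i.succ := by simp [Fin.ext_iff]
      rw [s_apply, ipH_ex]
      simp [simpleRoot, ex_apply, h.symm]
    rw [← this]
    exact s_mem_M _ ih

theorem s_line (j : Fin 8) (m : Fin 9) (h1 : m ≠ j.castSucc) (h2 : m ≠ j.succ) :
    s j.succ (e 0 - ex j.castSucc - ex m) = e 0 - ex j.succ - ex m := by
  have h : j.castSucc ≠ j.succ := by simp [Fin.ext_iff]
  rw [s_apply, map_sub, map_sub, ipH_ex, ipH_ex, ipH_e_zero]
  simp [simpleRoot, ex_apply, h, h1, h2, (Fin.succ_ne_zero _).symm]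
  abel

theorem line_mem_M_zero (l : Fin 9) (hl : l ≠ 0) : e 0 - ex 0 - ex l ∈ M := by
  induction l using Fin.induction with
  | zero => exact absurd rfl hl
  | succ l ih =>
    by_cases h : l = 0
    · subst h
      have : s 0 (ex 2) = e 0 - ex 0 - ex (Fin.succ 0) := by
        rw [s_apply, ipH_ex]
        have h3 : simpleRoot 0 = e 0 - ex 0 - ex 1 - ex 2 := rfl
        rw [h3]
        simp [e_apply, ex_apply]
      rw [← this]
      exact s_mem_M _ (ex_mem_M _)
    · have h0 : l.castSucc ≠ 0 := fun h' => h (Fin.castSucc_injective _ h')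
      have := s_mem_M l.succ (ih h0)
      rwa [sub_right_comm, s_line l 0 h0.symm (Fin.succ_ne_zero _).symm, sub_right_comm] at this

theorem line_mem_M_lt (i l : Fin 9) (h : i < l) : e 0 - ex i - ex l ∈ M := by
  induction i using Fin.induction with
  | zero => exact line_mem_M_zero l (Fin.ne_of_gt h)
  | succ i ih =>
    have hi : i.castSucc < l := lt_trans (Fin.castSucc_lt_succ) h
    rw [← s_line i l hi.ne' h.ne']
    exact s_mem_M _ (ih hi)

theorem line_mem_M (i l : Fin 9) (h : i ≠ l) : e 0 - ex i - ex l ∈ M := by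
  rcases lt_or_gt_of_ne h with h | h
  · exact line_mem_M_lt i l h
  · rw [sub_right_comm]; exact line_mem_M_lt l i h

/-- `e_i ∈ M`. -/
def mEx (i : Fin 9) : M := ⟨ex i, ex_mem_M i⟩

/-- `e_0 - e_i - e_l ∈ M`, for `i ≠ l`. -/
def mLine (i l : Fin 9) (h : i ≠ l) : M := ⟨e 0 - ex i - ex l, line_mem_M i l h⟩

/-- `e_{jk} = e_j - e_k ∈ 𝔥_0`. -/
def e2 (j k : Fin 9) : H0 := ⟨ex j - ex k, by simp [mem_H0, ipH_ex, c_succ]⟩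

/-- `e_{jkl} = e_0 - e_j - e_k - e_l ∈ 𝔥_0`. -/
def e3 (j k l : Fin 9) : H0 :=
  ⟨e 0 - ex j - ex k - ex l, by simp [mem_H0, ipH_ex, ipH_e_zero, c_succ, c_zero]; norm_num⟩

/-! ## Functions on `𝔥 / ℂc` -/

/-- The quotient `𝔥 / ℂc`. -/
abbrev Hbar : Type := H ⧸ Submodule.span ℂ {c}

/-- For `α ∈ 𝔥_0`, the linear form `⟨α, ·⟩` on `𝔥 / ℂc`. -/
noncomputable def pairBar (α : H0) : Hbar →ₗ[ℂ] ℂ :=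
  (Submodule.span ℂ {c}).liftQ (ipH (α : H)) (by
    rw [Submodule.span_singleton_le_iff_mem, LinearMap.mem_ker, ipH_comm]
    exact α.2)

/-- `σ_α = [⟨α, ·⟩]` on `𝔥 / ℂc`, for `α ∈ 𝔥_0`. -/
noncomputable def sigma (br : ℂ → ℂ) (α : H0) (z : Hbar) : ℂ := br (pairBar α z)

/-- The action of the extended group on `𝔥 / ℂc`. -/
noncomputable def actBar (g : Wext) : Hbar →ₗ[ℂ] Hbar :=
  (Submodule.span ℂ {c}).mapQ (Submodule.span ℂ {c}) (g : H ≃ₗ[ℂ] H).toLinearMap (by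
    rw [Submodule.span_singleton_le_iff_mem, Submodule.mem_comap]
    have h : (g : H ≃ₗ[ℂ] H).toLinearMap c = c := (Wext_le_Stab g.2).1
    rw [h]
    exact Submodule.mem_span_singleton_self c)

/-! ## Systems of lattice tau-functions -/

/-- A system of lattice tau-functions `τ_Λ` (`Λ ∈ M`), defined on a subset `S` of a
`W(E_8^{(1)})`-set `Y` with a map `γ : Y → 𝔥 / ℂc`: the set `S` is stable, `w.τ_Λ = τ_{w.Λ}` for
`w ∈ W(E_8^{(1)})`, where `(w.φ)(y) = φ(w⁻¹.y)`, and the bilinear equations hold on `S` for all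
mutually distinct `i, j, k, l`. Only the values of `τ_Λ` on `S` matter. -/
structure IsLatticeTau {Y : Type*} [MulAction Waff Y] (br : ℂ → ℂ) (γ : Y → Hbar) (S : Set Y)
    (τ : M → Y → ℂ) : Prop where
  stable : ∀ (w : Waff), ∀ y ∈ S, w • y ∈ S
  equivariant : ∀ (w : Waff) (Λ : M), ∀ y ∈ S, τ Λ (w⁻¹ • y) = τ (w • Λ) y
  bilinear : ∀ (i j k l : Fin 9) (_ : i ≠ j) (_ : i ≠ k) (hil : i ≠ l) (_ : j ≠ k) (hjl : j ≠ l)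
    (hkl : k ≠ l), ∀ y ∈ S,
    sigma br (e2 j k) (γ y) * sigma br (e3 j k l) (γ y) * τ (mEx i) y * τ (mLine i l hil) y +
    sigma br (e2 k i) (γ y) * sigma br (e3 k i l) (γ y) * τ (mEx j) y * τ (mLine j l hjl) y +
    sigma br (e2 i j) (γ y) * sigma br (e3 i j l) (γ y) * τ (mEx k) y * τ (mLine k l hkl) y = 0

/-- `τ` is an ORG tau-function on a subset `U` of a `T(Q(E_8)/2) ⋊ W(E_8)`-set `X` with a map
`γ : X → 𝔥 / ℂc`: the equations
`σ_{a₁±a₂} T_{a₀}.τ T_{a₀}⁻¹.τ + σ_{a₂±a₀} T_{a₁}.τ T_{a₁}⁻¹.τ + σ_{a₀±a₁} T_{a₂}.τ T_{a₂}⁻¹.τ = 0`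
hold for all `C_3`-frames `{±a₀, ±a₁, ±a₂}` where the functions in them are defined. If `U` is
stable by the translations `T_a`, `a ∈ Q(E_8)`, each of them has the domain `T_{a₀}.U`. -/
def IsORGOn {X : Type*} [MulAction Wext X] (br : ℂ → ℂ) (γ : X → Hbar) (U : Set X)
    (τ : X → ℂ) : Prop :=
  ∀ (a₀ a₁ a₂ : V) (h : IsC3Frame a₀ a₁ a₂) (x : X), (transl a₀ h.two_a)⁻¹ • x ∈ U →
    sigma br (iota0 (a₁ + a₂)) (γ x) * sigma br (iota0 (a₁ - a₂)) (γ x) *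
      (τ ((transl a₀ h.two_a)⁻¹ • x) * τ (transl a₀ h.two_a • x)) +
    sigma br (iota0 (a₂ + a₀)) (γ x) * sigma br (iota0 (a₂ - a₀)) (γ x) *
      (τ ((transl a₁ h.two_b)⁻¹ • x) * τ (transl a₁ h.two_b • x)) +
    sigma br (iota0 (a₀ + a₁)) (γ x) * sigma br (iota0 (a₀ - a₁)) (γ x) *
      (τ ((transl a₂ h.two_c)⁻¹ • x) * τ (transl a₂ h.two_c • x)) = 0

/-! ## The covering space -/

/-- The covering space `W(E_8) × X` of `X`. -/
@[ext] structure Cover (X : Type*) where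
  w : WE8
  pt : X

/-- The action `T_a w.(w', x) = (w w', T_a w.x)`. -/
noncomputable instance {X : Type*} [MulAction Wext X] : MulAction Wext (Cover X) where
  smul g y := ⟨finPart g * y.w, g • y.pt⟩
  one_smul y := Cover.ext (by change finPart 1 * y.w = y.w; simp) (one_smul _ _)
  mul_smul g g' y := Cover.ext
    (by change finPart (g * g') * y.w = finPart g * (finPart g' * y.w); simp [mul_assoc])
    (mul_smul g g' y.pt)

/-- The action of the subgroup `W(E_8^{(1)})` on the covering space. -/
noncomputable instance {X : Type*} [MulAction Wext X] : MulAction Waff (Cover X) :=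
  MulAction.compHom (Cover X) (Subgroup.inclusion Waff_le_Wext)

/-- `Ũ = {(w, x) | x ∈ w.U}`. -/
def coverSet {X : Type*} [MulAction Wext X] (U : Set X) : Set (Cover X) :=
  {y | ∃ u ∈ U, y.pt = emb y.w • u}

/-- `τ̃(w, x) = τ(w⁻¹.x)`. -/
noncomputable def coverFun {X : Type*} [MulAction Wext X] (τ : X → ℂ) (y : Cover X) : ℂ :=
  τ ((emb y.w)⁻¹ • y.pt)

end E8Tau

/-!
The functions `τ̃_Λ = T_{Λ - e_9}⁻¹.τ̃` are permuted correctly by `W(E_8^{(1)})` for every `τ`: if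
`w` is the linear part of `g`, then `T_{gΛ - e_9} g = w T_{Λ - e_9}` (`translM_smul_mul`), and `τ̃`
is invariant under `W(E_8)` (`coverFun_emb_smul`). So only the bilinear equations matter.

For fixed `l`, the pairs `e_i`, `e_0 - e_i - e_l` have the common midpoint `(e_0 - e_l)/2`, and the
half differences `e_i - (e_0 - e_l)/2` are orthonormal; the difference of the `j`-th and the `k`-th
one is `e_{jk}` and their sum is `-e_{jkl}`. Hence their classical parts form `C_3`-frames, and the
bilinear equation for `i, j, k, l` at a point `(w, x)` of the covering space is, up to sign, the
equation of the `w⁻¹`-image of such a frame at `w⁻¹.T_m.x`, where `m` is the classical part of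
`(e_0 - e_l)/2 - e_9` (`lattice_expr_eq`). The sign comes from the oddness of the bracket, and the
shift by `m` cancels the multiple of `c` lost on passing to classical parts
(`pairBar_actBar_midVec`).

This shows that ORG `τ`-functions give lattice `τ`-functions. Conversely, the frames for `l = 9` are
`{±v_i, ±v_j, ±v_k}`, and each `C_3`-frame is conjugate to one of these (`IsC3Frame.exists_WE8`): a
vector of norm `4` in `P` is taken to some `±2v_i` by at most two reflections, and unit vectors
congruent to `±v_i` modulo `P` are again of the form `±v_j`. Changing the signs of the members of a
frame does not affect the equation.

The statement on functions on `V` is the case `X = 𝔥` with `τ` replaced by `τ ∘ π`, on the part of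
level `κ`, where `π` turns the Kac translation `T_a` into the translation by `κa`.
-/

namespace E8Tau

/-! ### The bracket is an odd function -/

theorem IsBracket.apply_zero {br : ℂ → ℂ} (hbr : IsBracket br) : br 0 = 0 := by
  obtain ⟨z, hz⟩ := hbr.nonzero
  have h := hbr.three_term z 0 0 0
  simp only [add_zero, sub_zero] at h
  have h' : br 0 ^ 2 * br z ^ 2 = 0 := by linear_combination h / 3
  simpa [hz] using h'

theorem IsBracket.apply_neg {br : ℂ → ℂ} (hbr : IsBracket br) (t : ℂ) : br (-t) = -br t := by
  obtain ⟨s, hs⟩ := hbr.nonzero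
  -- The three-term relation with `α + γ = s`, `α - γ = t` and `β = γ` factors; the factor
  -- depending on `z` is a product of two nonzero entire functions, so it is nonzero somewhere.
  set b : ℂ := (s - t) / 2
  have hprod : ∃ z, br (z + b) * br (z - b) ≠ 0 := by
    by_contra! h
    have h1 : AnalyticOnNhd ℂ (fun z => br (z + b)) Set.univ := fun z _ =>
      (hbr.entire.comp (differentiable_id.add_const b)).analyticAt z
    have h2 : AnalyticOnNhd ℂ (fun z => br (z - b)) Set.univ := fun z _ =>
      (hbr.entire.comp (differentiable_id.sub_const b)).analyticAt z
    rcases AnalyticOnNhd.eq_zero_or_eq_zero_of_mul_eq_zero h1 h2 (fun z _ => h z)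
      isPreconnected_univ with h0 | h0
    · exact hs (by simpa using h0 (s - b) trivial)
    · exact hs (by simpa using h0 (s + b) trivial)
  obtain ⟨z, hz⟩ := hprod
  have h := hbr.three_term z ((s + t) / 2) b b
  rw [sub_self, hbr.apply_zero, show b + (s + t) / 2 = s by ring,
    show b - (s + t) / 2 = -t by ring, show (s + t) / 2 + b = s by ring,
    show (s + t) / 2 - b = t by ring] at h
  have h' : br s * (br (z + b) * br (z - b)) * (br (-t) + br t) = 0 := by linear_combination h
  rcases mul_eq_zero.1 h' with h' | h'
  · exact absurd h' (mul_ne_zero hs hz)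
  · exact eq_neg_of_add_eq_zero_left h'

/-! ### The lattice `P` -/

theorem ipV_comm (x y : V) : ipV x y = ipV y x := by
  simp [ipV_apply, mul_comm]

theorem phi_apply (j : Fin 8) : phi j = 1 / 2 := rfl

theorem zero_mem_P : (0 : V) ∈ P :=
  ⟨Or.inl fun j => ⟨0, by simp⟩, ⟨0, by simp⟩⟩

theorem neg_mem_P {a : V} (ha : a ∈ P) : -a ∈ P := by
  obtain ⟨h | h, n, hn⟩ := ha <;> choose m hm using h
  · exact ⟨Or.inl fun j => ⟨-m j, by simp [hm]⟩, -n, by simp [hn]⟩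
  · exact ⟨Or.inr fun j => ⟨-m j - 1, by simp [hm, phi_apply]; ring⟩, -n, by simp [hn]⟩

theorem add_mem_P {a b : V} (ha : a ∈ P) (hb : b ∈ P) : a + b ∈ P := by
  obtain ⟨ha, n, hn⟩ := ha
  obtain ⟨hb, n', hn'⟩ := hb
  refine ⟨?_, n + n', by simp [hn, hn']⟩
  rcases ha with h | h <;> rcases hb with h' | h' <;> choose m hm using h <;>
    choose m' hm' using h'
  · exact Or.inl fun j => ⟨m j + m' j, by simp [hm, hm']⟩
  · exact Or.inr fun j => ⟨m j + m' j, by simp [hm, hm']; ring⟩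
  · exact Or.inr fun j => ⟨m j + m' j, by simp [hm, hm']; ring⟩
  · exact Or.inl fun j => ⟨m j + m' j + 1, by simp [hm, hm', phi_apply]; ring⟩

/-- The root lattice `P` as an additive subgroup. -/
def PSub : AddSubgroup V where
  carrier := P
  add_mem' := add_mem_P
  zero_mem' := zero_mem_P
  neg_mem' := neg_mem_P

theorem sub_mem_P {a b : V} (ha : a ∈ P) (hb : b ∈ P) : a - b ∈ P := PSub.sub_mem ha hb

theorem int_smul_mem_P (n : ℤ) {a : V} (ha : a ∈ P) : (n : ℂ) • a ∈ P := by
  rw [Int.cast_smul_eq_zsmul]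
  exact PSub.zsmul_mem ha n

theorem two_smul_mem_P {a : V} (ha : a ∈ P) : (2 : ℂ) • a ∈ P := by
  exact_mod_cast int_smul_mem_P 2 ha

theorem phi_mem_P : phi ∈ P :=
  ⟨Or.inr fun j => ⟨0, by simp⟩, 2, by simp [ipV_apply, phi_apply]; norm_num⟩

/-- The lattice `P` is integral: half-integral vectors reduce to integral ones on subtracting
`φ`, whose pairing with `P` is integral by definition. -/
theorem ipV_int {a b : V} (ha : a ∈ P) (hb : b ∈ P) : ∃ n : ℤ, ipV a b = n := by
  have key : ∀ {a b : V}, (∀ j, ∃ n : ℤ, a j = n) → a ∈ P → b ∈ P → ∃ n : ℤ, ipV a b = n := by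
    intro a b h ha hb
    choose m hm using h
    obtain ⟨-, n, hn⟩ := ha
    obtain ⟨h' | h', -⟩ := hb <;> choose m' hm' using h'
    · exact ⟨∑ j, m j * m' j, by simp [ipV_apply, hm, hm']⟩
    · refine ⟨n + ∑ j, m j * m' j, ?_⟩
      push_cast
      rw [← hn]
      simp only [ipV_apply, hm, hm', ← Finset.sum_add_distrib]
      exact Finset.sum_congr rfl fun j _ => by ring
  rcases ha.1 with h | h
  · exact key h ha hb
  · obtain ⟨n, hn⟩ := key (a := a - phi) (fun j => by
      obtain ⟨n, hn⟩ := h j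
      exact ⟨n, by simp [hn]⟩) (sub_mem_P ha phi_mem_P) hb
    obtain ⟨n', hn'⟩ := hb.2
    refine ⟨n + n', ?_⟩
    rw [map_sub, LinearMap.sub_apply] at hn
    push_cast
    linear_combination hn + hn'

/-! ### The Weyl group `W(E_8)` acts on `P` by isometries -/

theorem reflV_mem_WE8 {α : V} (hα : α ∈ Delta) : reflV α hα.2 ∈ WE8 :=
  Subgroup.subset_closure ⟨α, hα, rfl⟩

theorem WE8_isometry {w : V ≃ₗ[ℂ] V} (hw : w ∈ WE8) (x y : V) : ipV (w x) (w y) = ipV x y := by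
  have hrefl (α : V) (hα : ipV α α = 2) (x y : V) :
      ipV (reflV α hα x) (reflV α hα y) = ipV x y := by
    simp only [reflV_apply, map_sub, map_smul, LinearMap.sub_apply, LinearMap.smul_apply, hα,
      smul_eq_mul, ipV_comm x α]
    ring
  induction hw using Subgroup.closure_induction'' generalizing x y with
  | mem g hg => obtain ⟨α, hα, rfl⟩ := hg; exact hrefl α hα.2 x y
  | inv_mem g hg => obtain ⟨α, hα, rfl⟩ := hg; exact hrefl α hα.2 x y
  | one => rfl
  | mul g g' _ _ hg hg' => exact (hg _ _).trans (hg' _ _)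

theorem WE8_mem_P {w : V ≃ₗ[ℂ] V} (hw : w ∈ WE8) {x : V} (hx : x ∈ P) : w x ∈ P := by
  have hrefl (α : V) (hα : α ∈ Delta) {x : V} (hx : x ∈ P) : reflV α hα.2 x ∈ P := by
    obtain ⟨n, hn⟩ := ipV_int hα.1 hx
    rw [reflV_apply, hn]
    exact sub_mem_P hx (int_smul_mem_P n hα.1)
  induction hw using Subgroup.closure_induction'' generalizing x with
  | mem g hg => obtain ⟨α, hα, rfl⟩ := hg; exact hrefl α hα hx
  | inv_mem g hg => obtain ⟨α, hα, rfl⟩ := hg; exact hrefl α hα hx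
  | one => exact hx
  | mul g g' _ _ hg hg' => exact hg (hg' hx)

theorem two_smul_WE8_mem_P (w : WE8) {a : V} (ha : (2 : ℂ) • a ∈ P) :
    (2 : ℂ) • (w : V ≃ₗ[ℂ] V) a ∈ P := by
  rw [← map_smul]
  exact WE8_mem_P w.2 ha

theorem WE8_apply_inv_apply (w : WE8) (x : V) :
    (w⁻¹ : WE8).1 ((w : V ≃ₗ[ℂ] V) x) = x := by
  rw [← LinearEquiv.mul_apply, ← Subgroup.coe_mul, inv_mul_cancel]
  rfl

theorem IsC3Frame.map {a b c : V} (h : IsC3Frame a b c) (w : WE8) :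
    IsC3Frame (w.1 a) (w.1 b) (w.1 c) where
  aa := by rw [WE8_isometry w.2, h.aa]
  bb := by rw [WE8_isometry w.2, h.bb]
  cc := by rw [WE8_isometry w.2, h.cc]
  ab := by rw [WE8_isometry w.2, h.ab]
  bc := by rw [WE8_isometry w.2, h.bc]
  ca := by rw [WE8_isometry w.2, h.ca]
  ab_add := by rw [← map_add]; exact WE8_mem_P w.2 h.ab_add
  ab_sub := by rw [← map_sub]; exact WE8_mem_P w.2 h.ab_sub
  bc_add := by rw [← map_add]; exact WE8_mem_P w.2 h.bc_add
  bc_sub := by rw [← map_sub]; exact WE8_mem_P w.2 h.bc_sub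
  ca_add := by rw [← map_add]; exact WE8_mem_P w.2 h.ca_add
  ca_sub := by rw [← map_sub]; exact WE8_mem_P w.2 h.ca_sub
  two_a := two_smul_WE8_mem_P w h.two_a
  two_b := two_smul_WE8_mem_P w h.two_b
  two_c := two_smul_WE8_mem_P w h.two_c

/-! ### The extended affine group -/

theorem ipH_c_iota (x : V) : ipH c (iota x) = 0 := iota_mem_H0 x

theorem ipH_iota_c (x : V) : ipH (iota x) c = 0 := by rw [ipH_comm]; exact iota_mem_H0 x

theorem kac_iota0_apply (a : V) (h : H) :
    kac (iota0 a) h =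
      h + ipH c h • iota a - ((1 / 2 : ℂ) * ipV a a * ipH c h + ipV a (proj h)) • c := by
  rw [kac_apply, kacLin_apply, iota0_coe, ipH_iota_iota, ipH_iota_left]

theorem transl_congr {a b : V} (h : a = b) (ha : (2 : ℂ) • a ∈ P) (hb : (2 : ℂ) • b ∈ P) :
    transl a ha = transl b hb := by
  subst h; rfl

theorem transl_mul (a b : V) (ha : (2 : ℂ) • a ∈ P) (hb : (2 : ℂ) • b ∈ P)
    (hab : (2 : ℂ) • (a + b) ∈ P) : transl a ha * transl b hb = transl (a + b) hab := by
  refine Subtype.ext (LinearEquiv.ext fun h => ?_)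
  change kac (iota0 a) (kac (iota0 b) h) = kac (iota0 (a + b)) h
  rw [kac_iota0_apply, kac_iota0_apply, kac_iota0_apply]
  simp only [map_add, map_sub, map_smul, ipH_c_iota, ipH_c_c, proj_iota, proj_c,
    LinearMap.add_apply, ipV_comm b a, smul_eq_mul, map_zero]
  module

theorem transl_zero (h0 : (2 : ℂ) • (0 : V) ∈ P) : transl 0 h0 = 1 := by
  refine Subtype.ext (LinearEquiv.ext fun h => ?_)
  change kac (iota0 0) h = h
  rw [kac_iota0_apply]
  simp

theorem transl_inv (a : V) (ha : (2 : ℂ) • a ∈ P) (hna : (2 : ℂ) • (-a) ∈ P) :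
    (transl a ha)⁻¹ = transl (-a) hna := by
  rw [inv_eq_iff_mul_eq_one, transl_mul _ _ _ _ (by simpa using zero_mem_P),
    transl_congr (add_neg_cancel a) _ (by simpa using zero_mem_P), transl_zero]

theorem emb_mul (w w' : WE8) : emb (w * w') = emb w * emb w' :=
  Subtype.ext (LinearEquiv.ext fun h => (extLin_extLin w.1 w'.1 h).symm)

theorem emb_one : emb 1 = 1 := Subtype.ext (LinearEquiv.ext extLin_one)

theorem emb_inv (w : WE8) : emb w⁻¹ = (emb w)⁻¹ := by
  rw [eq_inv_iff_mul_eq_one, ← emb_mul, inv_mul_cancel, emb_one]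

theorem emb_mul_transl (w : WE8) (a : V) (ha : (2 : ℂ) • a ∈ P) (hwa : (2 : ℂ) • w.1 a ∈ P) :
    emb w * transl a ha = transl (w.1 a) hwa * emb w := by
  refine Subtype.ext (LinearEquiv.ext fun h => ?_)
  change ext w.1 (kac (iota0 a) h) = kac (iota0 (w.1 a)) (ext w.1 h)
  simp only [kac_iota0_apply, ext_apply, map_add, map_sub, map_smul, ipH_c_iota, proj_iota,
    proj_c, WE8_isometry w.2, sub_zero, sub_self, add_zero, zero_add, map_zero]
  module

theorem emb_inv_mul_transl (w : WE8) (a : V) (ha : (2 : ℂ) • a ∈ P)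
    (hwa : (2 : ℂ) • (w⁻¹ : WE8).1 a ∈ P) :
    (emb w)⁻¹ * transl a ha = transl ((w⁻¹ : WE8).1 a) hwa * (emb w)⁻¹ := by
  rw [← emb_inv, emb_mul_transl]

/-- The decomposition of an element of `T(P/2) ⋊ W(E_8)`. -/
theorem exists_transl_mul_emb (g : Wext) :
    ∃ (a : V) (ha : (2 : ℂ) • a ∈ P), g = transl a ha * emb (finPart g) := by
  suffices h : ∃ (a : V) (ha : (2 : ℂ) • a ∈ P) (w : WE8), g = transl a ha * emb w by
    obtain ⟨a, ha, w, rfl⟩ := h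
    exact ⟨a, ha, by rw [map_mul, finPart_transl, finPart_emb, one_mul]⟩
  have h0 : (2 : ℂ) • (0 : V) ∈ P := by simpa using zero_mem_P
  obtain ⟨g, hg⟩ := g
  have hg' := hg
  rw [Wext] at hg'
  induction hg' using Subgroup.closure_induction with
  | mem g hg' =>
    rcases hg' with ⟨a, ha, rfl⟩ | ⟨w, hw, rfl⟩
    · exact ⟨a, ha, 1, by rw [emb_one, mul_one]; rfl⟩
    · exact ⟨0, h0, ⟨w, hw⟩, by rw [transl_zero, one_mul]; rfl⟩
  | one => exact ⟨0, h0, 1, by rw [transl_zero, one_mul, emb_one]; rfl⟩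
  | mul g g' hg1 hg2 ih ih' =>
    obtain ⟨a, ha, w, h1⟩ := ih hg1
    obtain ⟨b, hb, w', h2⟩ := ih' hg2
    have hwb := two_smul_WE8_mem_P w hb
    have hab : (2 : ℂ) • (a + w.1 b) ∈ P := by rw [smul_add]; exact add_mem_P ha hwb
    refine ⟨a + w.1 b, hab, w * w', ?_⟩
    calc (⟨g * g', hg⟩ : Wext) = ⟨g, hg1⟩ * ⟨g', hg2⟩ := rfl
      _ = transl a ha * (emb w * transl b hb) * emb w' := by rw [h1, h2]; simp only [mul_assoc]
      _ = _ := by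
        rw [emb_mul_transl w b hb hwb, ← mul_assoc, transl_mul a _ ha hwb hab, mul_assoc,
          ← emb_mul]
  | inv g hg1 ih =>
    obtain ⟨a, ha, w, h1⟩ := ih hg1
    have hna : (2 : ℂ) • (-a) ∈ P := by rw [smul_neg]; exact neg_mem_P ha
    refine ⟨(w⁻¹ : WE8).1 (-a), two_smul_WE8_mem_P _ hna, w⁻¹, ?_⟩
    calc (⟨g⁻¹, hg⟩ : Wext) = (⟨g, hg1⟩ : Wext)⁻¹ := rfl
      _ = (emb w)⁻¹ * transl (-a) hna := by rw [h1, mul_inv_rev, transl_inv _ _ hna]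
      _ = _ := by rw [emb_inv_mul_transl w _ _ (two_smul_WE8_mem_P _ hna), emb_inv]

theorem e_nine_eq : e 9 = ex 8 := rfl

theorem ipH_c_ex (i : Fin 9) : ipH c (ex i) = -1 := by rw [ipH_ex, c_succ]

theorem ipH_c_e_zero : ipH c (e 0) = -3 := by rw [ipH_e_zero, c_zero]

theorem proj_e_nine : proj (e 9) = 0 := by
  have h (j : Fin 9) (hj : j ≠ 8) : ipH (vAux j) (ex 8) = 0 := by
    rw [ipH_vAux, ipH_c_ex, show (9 : Fin 10) = (8 : Fin 9).succ from rfl]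
    simp only [ex_apply, Fin.succ_inj, hj, (Fin.succ_ne_zero _).symm, if_true, if_false]
    norm_num
  ext j
  rw [proj_apply, e_nine_eq]
  refine Fin.cases ?_ (fun j => ?_) j
  · simp [v, h 7 (by decide)]
  · refine h _ fun h => ?_
    have := congrArg Fin.val h
    simp at this
    omega

/-- The elements of `W(E_8^{(1)})` have translation part in `P`. -/
theorem exists_transl_mul_emb_of_Waff (g : Waff) :
    ∃ (a : V) (_ : a ∈ P) (ha : (2 : ℂ) • a ∈ P),
      Subgroup.inclusion Waff_le_Wext g =
        transl a ha * emb (finPart (Subgroup.inclusion Waff_le_Wext g)) := by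
  obtain ⟨a, ha, h⟩ := exists_transl_mul_emb (Subgroup.inclusion Waff_le_Wext g)
  refine ⟨a, ?_, ha, h⟩
  -- `g e_9 - e_9` lies in `L ∩ 𝔥_0`, and its classical part is `-a`.
  have hg : (g : H ≃ₗ[ℂ] H) (e 9) =
      kac (iota0 a) (ext (finPart (Subgroup.inclusion Waff_le_Wext g)).1 (e 9)) :=
    congrArg (fun k : Wext => (k : H ≃ₗ[ℂ] H) (e 9)) h
  have hP : proj ((g : H ≃ₗ[ℂ] H) (e 9) - e 9) ∈ P := by
    refine proj_mem_P (sub_mem (mem_L_of_Waff g.2 _ (e_mem_L 9)) (e_mem_L 9)) ?_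
    rw [mem_H0, map_sub, (Waff_le_Stab g.2).2, sub_self]
  rw [hg, ext_apply, proj_e_nine] at hP
  simp only [map_zero, sub_zero, zero_add, kac_iota0_apply, proj_e_nine, map_sub, map_add,
    map_smul, proj_iota, proj_c, smul_zero] at hP
  rw [e_nine_eq, ipH_c_ex, neg_one_smul] at hP
  simpa using neg_mem_P hP

theorem proj_sub_e_nine_mem_P (Λ : M) : proj ((Λ : H) - e 9) ∈ P :=
  proj_mem_P (sub_mem (M_mem_L Λ) (e_mem_L 9)) (M_sub_mem_H0 Λ)

theorem translM_eq (Λ : M) (h : (2 : ℂ) • proj ((Λ : H) - e 9) ∈ P) :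
    translM Λ = transl (proj ((Λ : H) - e 9)) h :=
  Subtype.ext (kac_eq_kac_proj _)

/-- `T_{gΛ - e_9} g = w T_{Λ - e_9}` if `w` is the linear part of `g`. -/
theorem translM_smul_mul (g : Waff) (Λ : M) :
    translM (g • Λ) * Subgroup.inclusion Waff_le_Wext g =
      emb (finPart (Subgroup.inclusion Waff_le_Wext g)) * translM Λ := by
  obtain ⟨a, haP, ha, h⟩ := exists_transl_mul_emb_of_Waff g
  set w := finPart (Subgroup.inclusion Waff_le_Wext g)
  have h2 := two_smul_mem_P (proj_sub_e_nine_mem_P Λ)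
  have hg : ((g • Λ : M) : H) = kac (iota0 a) (ext w.1 Λ) :=
    congrArg (fun k : Wext => (k : H ≃ₗ[ℂ] H) Λ) h
  have hΛ : ipH c Λ = -1 := by
    have := M_sub_mem_H0 Λ
    rw [mem_H0, map_sub, e_nine_eq, ipH_c_ex] at this
    linear_combination this
  have hp : proj ((g • Λ : M) - e 9) + a = w.1 (proj (Λ - e 9)) := by
    rw [hg, ext_apply]
    simp only [sub_zero, kac_iota0_apply, proj_e_nine, map_sub, map_add,
      map_smul, proj_iota, proj_c, smul_zero, hΛ, ipH_c_iota]
    module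
  have h2' := two_smul_WE8_mem_P w h2
  rw [translM_eq _ h2, translM_eq _ (two_smul_mem_P (proj_sub_e_nine_mem_P _)), h,
    emb_mul_transl w _ _ h2', ← mul_assoc, transl_mul _ _ _ _ (by rw [hp]; exact h2')]
  congr 1
  exact transl_congr hp _ _


/-! ### The linear forms `⟨α, ·⟩` on `𝔥 / ℂc` -/

theorem pairBar_mk (α : H0) (h : H) :
    pairBar α (Submodule.Quotient.mk h) = ipH (α : H) h := rfl

theorem actBar_mk (g : Wext) (h : H) :
    actBar g (Submodule.Quotient.mk h) = Submodule.Quotient.mk ((g : H ≃ₗ[ℂ] H) h) := rfl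

theorem sigma_neg {br : ℂ → ℂ} (hbr : IsBracket br) (α : H0) (z : Hbar) :
    sigma br (-α) z = -sigma br α z := by
  obtain ⟨h, rfl⟩ := Submodule.Quotient.mk_surjective _ z
  rw [sigma, sigma, pairBar_mk, pairBar_mk, ← hbr.apply_neg]
  simp

theorem pairBar_actBar_emb_inv (w : WE8) (a : V) (z : Hbar) :
    pairBar (iota0 ((w⁻¹ : WE8).1 a)) (actBar (emb w)⁻¹ z) = pairBar (iota0 a) z := by
  obtain ⟨h, rfl⟩ := Submodule.Quotient.mk_surjective _ z
  rw [← emb_inv, actBar_mk, pairBar_mk, pairBar_mk, iota0_coe, iota0_coe, ipH_iota_left,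
    ipH_iota_left]
  change ipV _ (proj (ext (w⁻¹ : WE8).1 h)) = _
  rw [ext_apply]
  simp only [map_add, map_sub, proj_iota, sub_self, add_zero, WE8_isometry (w⁻¹ : WE8).2]

theorem ipV_proj_proj_eq {α β : H} (hα : α ∈ H0) (hβ : β ∈ H0) :
    ipV (proj α) (proj β) = ipH α β := by
  conv_rhs => rw [H0_decomp α hα]
  rw [map_sub, LinearMap.sub_apply, ipH_iota_left, map_smul, LinearMap.smul_apply,
    (mem_H0 β).1 hβ, smul_zero, sub_zero]

/-! ### The `C_3`-frames of the bilinear equations -/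

/-- The classical part of `e_i - (e_0 - e_l)/2`, half the difference of the classes `e_i` and
`e_0 - e_i - e_l` of `M`. -/
noncomputable def frameVec (i l : Fin 9) : V := proj (ex i - (1 / 2 : ℂ) • (e 0 - ex l))

/-- The classical part of `(e_0 - e_l)/2 - e_9`, the common midpoint of the pairs `e_i - e_9`,
`e_0 - e_i - e_l - e_9` for varying `i`. -/
noncomputable def midVec (l : Fin 9) : V := proj ((1 / 2 : ℂ) • (e 0 - ex l) - e 9)

theorem frame_mem_H0 (i l : Fin 9) : ex i - (1 / 2 : ℂ) • (e 0 - ex l) ∈ H0 := by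
  rw [mem_H0]
  simp only [map_sub, map_smul, ipH_c_ex, ipH_c_e_zero, smul_eq_mul]
  norm_num

theorem mid_mem_H0 (l : Fin 9) : (1 / 2 : ℂ) • (e 0 - ex l) - e 9 ∈ H0 := by
  rw [mem_H0]
  simp only [map_sub, map_smul, ipH_c_ex, ipH_c_e_zero, e_nine_eq, smul_eq_mul]
  norm_num

theorem frameVec_add_midVec (i l : Fin 9) : frameVec i l + midVec l = proj ((mEx i : H) - e 9) := by
  rw [frameVec, midVec, ← map_add]
  congr 1
  change _ = ex i - e 9
  abel

theorem midVec_sub_frameVec (i l : Fin 9) (h : i ≠ l) :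
    midVec l - frameVec i l = proj ((mLine i l h : H) - e 9) := by
  rw [frameVec, midVec, ← map_sub]
  congr 1
  change _ = e 0 - ex i - ex l - e 9
  module

theorem frameVec_sub (j k l : Fin 9) : frameVec j l - frameVec k l = proj (e2 j k : H) := by
  rw [frameVec, frameVec, ← map_sub]
  congr 1
  change _ = ex j - ex k
  abel

theorem frameVec_add (j k l : Fin 9) : frameVec j l + frameVec k l = -proj (e3 j k l : H) := by
  rw [frameVec, frameVec, ← map_add, ← map_neg]
  congr 1
  change _ = -(e 0 - ex j - ex k - ex l)
  module

theorem ex_mem_L (i : Fin 9) : ex i ∈ L := e_mem_L _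

theorem two_smul_frameVec_mem_P (i l : Fin 9) : (2 : ℂ) • frameVec i l ∈ P := by
  rw [frameVec, ← map_smul]
  refine proj_mem_P ?_ (H0.smul_mem _ (frame_mem_H0 i l))
  rw [show (2 : ℂ) • (ex i - (1 / 2 : ℂ) • (e 0 - ex l)) = (2 : ℂ) • ex i - (e 0 - ex l) by module]
  exact sub_mem (smul_mem_L ⟨2, by simp⟩ (ex_mem_L i)) (sub_mem (e_mem_L 0) (ex_mem_L l))

theorem two_smul_midVec_mem_P (l : Fin 9) : (2 : ℂ) • midVec l ∈ P := by
  rw [midVec, ← map_smul]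
  refine proj_mem_P ?_ (H0.smul_mem _ (mid_mem_H0 l))
  rw [show (2 : ℂ) • ((1 / 2 : ℂ) • (e 0 - ex l) - e 9) = (e 0 - ex l) - (2 : ℂ) • e 9 by module]
  exact sub_mem (sub_mem (e_mem_L 0) (ex_mem_L l)) (smul_mem_L ⟨2, by simp⟩ (e_mem_L 9))

theorem e2_proj_mem_P (j k : Fin 9) : proj (e2 j k : H) ∈ P :=
  proj_mem_P (sub_mem (ex_mem_L j) (ex_mem_L k)) (e2 j k).2

theorem e3_proj_mem_P (j k l : Fin 9) : proj (e3 j k l : H) ∈ P :=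
  proj_mem_P (sub_mem (sub_mem (sub_mem (e_mem_L 0) (ex_mem_L j)) (ex_mem_L k)) (ex_mem_L l))
    (e3 j k l).2

theorem ipV_frameVec (i j l : Fin 9) (hi : i ≠ l) (hj : j ≠ l) :
    ipV (frameVec i l) (frameVec j l) = if i = j then 1 else 0 := by
  rw [frameVec, frameVec, ipV_proj_proj_eq (frame_mem_H0 i l) (frame_mem_H0 j l)]
  simp only [map_sub, map_smul, LinearMap.sub_apply, LinearMap.smul_apply, ipH_ex, ipH_e_zero,
    ex_apply, e_apply, Fin.succ_inj, smul_eq_mul, hi.symm, hj,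
    Fin.succ_ne_zero, (Fin.succ_ne_zero _).symm, if_true, if_false, eq_comm (a := j)]
  by_cases h : i = j <;> simp [h]

theorem isC3Frame_frameVec {i j k l : Fin 9} (hij : i ≠ j) (hik : i ≠ k) (hil : i ≠ l)
    (hjk : j ≠ k) (hjl : j ≠ l) (hkl : k ≠ l) :
    IsC3Frame (frameVec i l) (frameVec j l) (frameVec k l) where
  aa := by simp [ipV_frameVec, *]
  bb := by simp [ipV_frameVec, *]
  cc := by simp [ipV_frameVec, *]
  ab := by simp [ipV_frameVec, *]
  bc := by simp [ipV_frameVec, *]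
  ca := by simp [ipV_frameVec, hik.symm, *]
  ab_add := by rw [frameVec_add]; exact neg_mem_P (e3_proj_mem_P _ _ _)
  ab_sub := by rw [frameVec_sub]; exact e2_proj_mem_P _ _
  bc_add := by rw [frameVec_add]; exact neg_mem_P (e3_proj_mem_P _ _ _)
  bc_sub := by rw [frameVec_sub]; exact e2_proj_mem_P _ _
  ca_add := by rw [frameVec_add]; exact neg_mem_P (e3_proj_mem_P _ _ _)
  ca_sub := by rw [frameVec_sub]; exact e2_proj_mem_P _ _
  two_a := two_smul_frameVec_mem_P i l
  two_b := two_smul_frameVec_mem_P j l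
  two_c := two_smul_frameVec_mem_P k l

/-- Shifting by the midpoint compensates exactly for replacing `α` by its classical part,
provided that `α` is orthogonal to `e_0 - e_l`. -/
theorem pairBar_actBar_midVec (α : H0) (l : Fin 9) (hα : ipH (α : H) (e 0 - ex l) = 0) (z : Hbar) :
    pairBar (iota0 (proj α)) (actBar (transl (midVec l) (two_smul_midVec_mem_P l)) z) =
      pairBar α z := by
  obtain ⟨h, rfl⟩ := Submodule.Quotient.mk_surjective _ z
  rw [actBar_mk, pairBar_mk, pairBar_mk, iota0_coe]
  change ipH (iota (proj α)) (kac (iota0 (midVec l)) h) = _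
  have hm : ipV (proj α) (midVec l) = -(α : H) 9 := by
    rw [midVec, ipV_proj_proj_eq α.2 (mid_mem_H0 l), map_sub, map_smul, hα, e_nine_eq, ipH_ex,
      smul_zero, zero_sub]
    rfl
  rw [kac_iota0_apply]
  simp only [map_add, map_sub, map_smul, ipH_iota_c, ipH_iota_iota, hm, smul_eq_mul, mul_zero,
    sub_zero]
  conv_rhs => rw [H0_decomp α α.2]
  simp only [map_sub, map_smul, LinearMap.sub_apply, LinearMap.smul_apply, smul_eq_mul]
  ring

theorem ipH_e2_line (j k l : Fin 9) (hj : j ≠ l) (hk : k ≠ l) :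
    ipH (e2 j k : H) (e 0 - ex l) = 0 := by
  change ipH (ex j - ex k) _ = 0
  rw [map_sub, ipH_ex, ipH_e_zero]
  simp [ex_apply, hj.symm, hk.symm, (Fin.succ_ne_zero _).symm]

theorem ipH_e3_line (j k l : Fin 9) (hj : j ≠ l) (hk : k ≠ l) :
    ipH (e3 j k l : H) (e 0 - ex l) = 0 := by
  change ipH (e 0 - ex j - ex k - ex l) _ = 0
  rw [map_sub, ipH_ex, ipH_e_zero]
  simp [e_apply, ex_apply, hj.symm, hk.symm, (Fin.succ_ne_zero _).symm]

/-! ### The two kinds of factors in the bilinear equations -/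

/-- `σ_{a±b} = σ_{a+b} σ_{a-b}`. -/
noncomputable def sigmaPair (br : ℂ → ℂ) (a b : V) (z : Hbar) : ℂ :=
  sigma br (iota0 (a + b)) z * sigma br (iota0 (a - b)) z

/-- `T_a.τ T_a⁻¹.τ`. -/
noncomputable def tauPair {X : Type*} [MulAction Wext X] (τ : X → ℂ) (a : V)
    (ha : (2 : ℂ) • a ∈ P) (x : X) : ℂ :=
  τ ((transl a ha)⁻¹ • x) * τ (transl a ha • x)

theorem sigmaPair_of_eq_or_eq_neg {br : ℂ → ℂ} (hbr : IsBracket br) {a a' b b' : V}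
    (ha : a = a' ∨ a = -a') (hb : b = b' ∨ b = -b') (z : Hbar) :
    sigmaPair br a b z = sigmaPair br a' b' z := by
  have h1 (a b : V) : sigmaPair br a (-b) z = sigmaPair br a b z := by
    rw [sigmaPair, sigmaPair, ← sub_eq_add_neg, sub_neg_eq_add, mul_comm]
  have h2 (a b : V) : sigmaPair br (-a) b z = sigmaPair br a b z := by
    rw [sigmaPair, sigmaPair, show -a + b = -(a - b) by abel, show -a - b = -(a + b) by abel,
      map_neg, map_neg, sigma_neg hbr, sigma_neg hbr]
    ring
  rcases ha with rfl | rfl <;> rcases hb with rfl | rfl <;> simp only [h1, h2]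

theorem tauPair_of_eq_or_eq_neg {X : Type*} [MulAction Wext X] (τ : X → ℂ) {a a' : V}
    (h : a = a' ∨ a = -a') (ha : (2 : ℂ) • a ∈ P) (ha' : (2 : ℂ) • a' ∈ P) (x : X) :
    tauPair τ a ha x = tauPair τ a' ha' x := by
  rcases h with rfl | rfl
  · rfl
  · rw [tauPair, tauPair, ← transl_inv a' ha' ha, inv_inv, mul_comm]

/-! ### The covering space -/

section Cover

variable {X : Type*} [MulAction Wext X]

theorem Cover.smul_mk (g : Wext) (w : WE8) (x : X) :
    g • (⟨w, x⟩ : Cover X) = ⟨finPart g * w, g • x⟩ := rfl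

theorem Cover.Waff_smul (g : Waff) (y : Cover X) :
    g • y = Subgroup.inclusion Waff_le_Wext g • y := rfl

/-- `τ̃` is invariant under `W(E_8)`. -/
theorem coverFun_emb_smul (τ : X → ℂ) (w : WE8) (y : Cover X) :
    coverFun τ (emb w • y) = coverFun τ y := by
  change τ ((emb (finPart (emb w) * y.w))⁻¹ • emb w • y.pt) = τ ((emb y.w)⁻¹ • y.pt)
  rw [finPart_emb, emb_mul, mul_inv_rev, mul_smul, inv_smul_smul]

theorem coverFun_transl_smul (τ : X → ℂ) (a : V) (ha : (2 : ℂ) • a ∈ P) (w : WE8) (x : X) :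
    coverFun τ (transl a ha • (⟨w, x⟩ : Cover X)) = τ ((emb w)⁻¹ • transl a ha • x) := by
  rw [Cover.smul_mk, finPart_transl, one_mul, coverFun]

/-- The functions `T_{Λ - e_9}⁻¹.τ̃` are permuted by `W(E_8^{(1)})`, whatever `τ` is. -/
theorem coverFun_equivariant (τ : X → ℂ) (g : Waff) (Λ : M) (y : Cover X) :
    coverFun τ (translM Λ • g⁻¹ • y) = coverFun τ (translM (g • Λ) • y) := by
  have h := eq_mul_inv_of_mul_eq (translM_smul_mul g Λ)
  rw [h, mul_smul, mul_smul, coverFun_emb_smul, Cover.Waff_smul, map_inv]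

theorem emb_inv_transl_smul (w : WE8) (a : V) (ha : (2 : ℂ) • a ∈ P)
    (hwa : (2 : ℂ) • (w⁻¹ : WE8).1 a ∈ P) (x : X) :
    (emb w)⁻¹ • transl a ha • x = transl ((w⁻¹ : WE8).1 a) hwa • (emb w)⁻¹ • x := by
  rw [smul_smul, emb_inv_mul_transl w a ha hwa, mul_smul]

theorem transl_smul_smul {a b e : V} (h : a + b = e) (ha : (2 : ℂ) • a ∈ P) (hb : (2 : ℂ) • b ∈ P)
    (he : (2 : ℂ) • e ∈ P) (x : X) : transl a ha • transl b hb • x = transl e he • x := by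
  subst h
  rw [smul_smul, transl_mul]

theorem coverSet_stable {U : Set X}
    (hU : ∀ (a : V) (ha : (2 : ℂ) • a ∈ P), a ∈ P → ∀ x ∈ U, transl a ha • x ∈ U)
    (g : Waff) {y : Cover X} (hy : y ∈ coverSet U) : g • y ∈ coverSet U := by
  obtain ⟨w, x⟩ := y
  obtain ⟨u, hu, rfl : x = emb w • u⟩ := hy
  obtain ⟨a, haP, ha, h⟩ := exists_transl_mul_emb_of_Waff g
  rw [Cover.Waff_smul, Cover.smul_mk]
  generalize Subgroup.inclusion Waff_le_Wext g = G at h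
  have ha' := WE8_mem_P (finPart G * w)⁻¹.2 haP
  refine ⟨_, hU _ (two_smul_mem_P ha') ha' u hu, ?_⟩
  change G • emb w • u = emb (finPart G * w) • _
  conv_lhs => rw [h, mul_smul, smul_smul (emb (finPart G)), ← emb_mul]
  rw [← inv_smul_eq_iff, emb_inv_transl_smul, inv_smul_smul]

theorem sigma_emb_inv_midVec {br : ℂ → ℂ} {γ : X → Hbar}
    (hγ : ∀ (g : Wext) (x : X), γ (g • x) = actBar g (γ x)) (α : H0) (l : Fin 9)
    (hα : ipH (α : H) (e 0 - ex l) = 0) (w : WE8) (x : X) :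
    sigma br (iota0 ((w⁻¹ : WE8).1 (proj α)))
      (γ ((emb w)⁻¹ • transl (midVec l) (two_smul_midVec_mem_P l) • x)) = sigma br α (γ x) := by
  rw [sigma, hγ, hγ, pairBar_actBar_emb_inv, pairBar_actBar_midVec α l hα, sigma]

theorem sigmaPair_frameVec {br : ℂ → ℂ} (hbr : IsBracket br) {γ : X → Hbar}
    (hγ : ∀ (g : Wext) (x : X), γ (g • x) = actBar g (γ x)) {j k l : Fin 9} (hj : j ≠ l)
    (hk : k ≠ l) (w : WE8) (x : X) :
    sigmaPair br ((w⁻¹ : WE8).1 (frameVec j l)) ((w⁻¹ : WE8).1 (frameVec k l))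
      (γ ((emb w)⁻¹ • transl (midVec l) (two_smul_midVec_mem_P l) • x)) =
      -(sigma br (e2 j k) (γ x) * sigma br (e3 j k l) (γ x)) := by
  rw [sigmaPair, ← map_add, ← map_sub, frameVec_add, frameVec_sub, map_neg, map_neg,
    sigma_neg hbr, sigma_emb_inv_midVec hγ _ l (ipH_e2_line j k l hj hk),
    sigma_emb_inv_midVec hγ _ l (ipH_e3_line j k l hj hk)]
  ring

theorem tauPair_frameVec (τ : X → ℂ) {i l : Fin 9} (hil : i ≠ l) (w : WE8)
    (hf : (2 : ℂ) • (w⁻¹ : WE8).1 (frameVec i l) ∈ P) (x : X) :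
    tauPair τ ((w⁻¹ : WE8).1 (frameVec i l)) hf
      ((emb w)⁻¹ • transl (midVec l) (two_smul_midVec_mem_P l) • x) =
      coverFun τ (translM (mEx i) • (⟨w, x⟩ : Cover X)) *
        coverFun τ (translM (mLine i l hil) • (⟨w, x⟩ : Cover X)) := by
  have h1 := two_smul_mem_P (proj_sub_e_nine_mem_P (mEx i))
  have h2 := two_smul_mem_P (proj_sub_e_nine_mem_P (mLine i l hil))
  have hn : (2 : ℂ) • (-(w⁻¹ : WE8).1 (frameVec i l)) ∈ P := by
    rw [smul_neg]; exact neg_mem_P hf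
  have hm := two_smul_WE8_mem_P w⁻¹ (two_smul_midVec_mem_P l)
  rw [translM_eq _ h1, translM_eq _ h2, coverFun_transl_smul, coverFun_transl_smul, tauPair,
    mul_comm, transl_inv _ hf hn, emb_inv_transl_smul w (midVec l) _ hm,
    emb_inv_transl_smul w _ h1 (two_smul_WE8_mem_P _ h1),
    emb_inv_transl_smul w _ h2 (two_smul_WE8_mem_P _ h2),
    transl_smul_smul (e := (w⁻¹ : WE8).1 (proj ((mEx i : H) - e 9)))
      (by rw [← map_add, frameVec_add_midVec]) _ _ (two_smul_WE8_mem_P _ h1),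
    transl_smul_smul (e := (w⁻¹ : WE8).1 (proj ((mLine i l hil : H) - e 9)))
      (by rw [← midVec_sub_frameVec, map_sub]; abel) _ _ (two_smul_WE8_mem_P _ h2)]

/-- The bilinear equation of a system of lattice `τ`-functions at `(w, x)` is the equation of the
`C_3`-frame `w⁻¹.frameVec` at the point `w⁻¹.T_{midVec}.x`. -/
theorem lattice_expr_eq {br : ℂ → ℂ} (hbr : IsBracket br) {γ : X → Hbar}
    (hγ : ∀ (g : Wext) (x : X), γ (g • x) = actBar g (γ x)) (τ : X → ℂ) {i j k l : Fin 9}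
    (hil : i ≠ l) (hjl : j ≠ l) (hkl : k ≠ l) (w : WE8) (x x' : X)
    (hx' : x' = (emb w)⁻¹ • transl (midVec l) (two_smul_midVec_mem_P l) • x)
    {a b c : V} (ha : (2 : ℂ) • a ∈ P) (hb : (2 : ℂ) • b ∈ P) (hc : (2 : ℂ) • c ∈ P)
    (hai : a = (w⁻¹ : WE8).1 (frameVec i l) ∨ a = -(w⁻¹ : WE8).1 (frameVec i l))
    (hbj : b = (w⁻¹ : WE8).1 (frameVec j l) ∨ b = -(w⁻¹ : WE8).1 (frameVec j l))
    (hck : c = (w⁻¹ : WE8).1 (frameVec k l) ∨ c = -(w⁻¹ : WE8).1 (frameVec k l)) :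
    sigma br (e2 j k) (γ x) * sigma br (e3 j k l) (γ x) *
        coverFun τ (translM (mEx i) • (⟨w, x⟩ : Cover X)) *
        coverFun τ (translM (mLine i l hil) • (⟨w, x⟩ : Cover X)) +
      sigma br (e2 k i) (γ x) * sigma br (e3 k i l) (γ x) *
        coverFun τ (translM (mEx j) • (⟨w, x⟩ : Cover X)) *
        coverFun τ (translM (mLine j l hjl) • (⟨w, x⟩ : Cover X)) +
      sigma br (e2 i j) (γ x) * sigma br (e3 i j l) (γ x) *
        coverFun τ (translM (mEx k) • (⟨w, x⟩ : Cover X)) *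
        coverFun τ (translM (mLine k l hkl) • (⟨w, x⟩ : Cover X)) =
    -(sigmaPair br b c (γ x') * tauPair τ a ha x' + sigmaPair br c a (γ x') * tauPair τ b hb x' +
      sigmaPair br a b (γ x') * tauPair τ c hc x') := by
  subst hx'
  rw [sigmaPair_of_eq_or_eq_neg hbr hbj hck, sigmaPair_of_eq_or_eq_neg hbr hck hai,
    sigmaPair_of_eq_or_eq_neg hbr hai hbj,
    tauPair_of_eq_or_eq_neg τ hai _ (two_smul_WE8_mem_P _ (two_smul_frameVec_mem_P i l)),
    tauPair_of_eq_or_eq_neg τ hbj _ (two_smul_WE8_mem_P _ (two_smul_frameVec_mem_P j l)),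
    tauPair_of_eq_or_eq_neg τ hck _ (two_smul_WE8_mem_P _ (two_smul_frameVec_mem_P k l)),
    sigmaPair_frameVec hbr hγ hjl hkl, sigmaPair_frameVec hbr hγ hkl hil,
    sigmaPair_frameVec hbr hγ hil hjl, tauPair_frameVec τ hil, tauPair_frameVec τ hjl,
    tauPair_frameVec τ hkl]
  ring

theorem isLatticeTau_of_isORGOn {br : ℂ → ℂ} (hbr : IsBracket br) {γ : X → Hbar}
    (hγ : ∀ (g : Wext) (x : X), γ (g • x) = actBar g (γ x)) {U : Set X}
    (hU : ∀ (a : V) (ha : (2 : ℂ) • a ∈ P), a ∈ P → ∀ x ∈ U, transl a ha • x ∈ U)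
    {τ : X → ℂ} (hτ : IsORGOn br γ U τ) :
    IsLatticeTau br (fun y : Cover X => γ y.pt) (coverSet U)
      (fun Λ y => coverFun τ (translM Λ • y)) where
  stable g _ hy := coverSet_stable hU g hy
  equivariant g Λ y _ := coverFun_equivariant τ g Λ y
  bilinear i j k l hij hik hil hjk hjl hkl y hy := by
    obtain ⟨w, x⟩ := y
    obtain ⟨u, hu, rfl : x = emb w • u⟩ := hy
    have hF := (isC3Frame_frameVec hij hik hil hjk hjl hkl).map w⁻¹
    refine (lattice_expr_eq hbr hγ τ hil hjl hkl w _ _ rfl hF.two_a hF.two_b hF.two_c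
      (Or.inl rfl) (Or.inl rfl) (Or.inl rfl)).trans (neg_eq_zero.2 (hτ _ _ _ hF _ ?_))
    have hP := WE8_mem_P w⁻¹.2 (proj_sub_e_nine_mem_P (mLine i l hil))
    have hn : (2 : ℂ) • (-(w⁻¹ : WE8).1 (frameVec i l)) ∈ P := by
      rw [smul_neg]; exact neg_mem_P hF.two_a
    rw [transl_inv _ _ hn,
      emb_inv_transl_smul w _ _ (two_smul_WE8_mem_P w⁻¹ (two_smul_midVec_mem_P l)), inv_smul_smul,
      transl_smul_smul (e := (w⁻¹ : WE8).1 (proj ((mLine i l hil : H) - e 9)))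
        (by rw [← midVec_sub_frameVec, map_sub]; abel) _ _ (two_smul_mem_P hP)]
    exact hU _ _ hP u hu

end Cover


/-! ### Conjugacy of `C_3`-frames under `W(E_8)` -/

theorem ipV_single (i : Fin 8) (x : V) : ipV (Pi.single i 1) x = x i := by
  simp [ipV_apply, Pi.single_apply]

theorem two_smul_single_mem_P (i : Fin 8) : (2 : ℂ) • (Pi.single i 1 : V) ∈ P := by
  refine ⟨Or.inl fun j => ?_, 1, ?_⟩
  · by_cases h : j = i
    · exact ⟨2, by simp [h]⟩
    · exact ⟨0, by simp [h]⟩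
  · rw [map_smul, ipV_comm, ipV_single, phi_apply]
    norm_num

/-- The reflection in the root `x - y` exchanges `x` and `y`. -/
theorem exists_WE8_apply_eq {x y : V} (hx : x ∈ P) (hy : y ∈ P) (hxx : ipV x x = 4)
    (hyy : ipV y y = 4) (hxy : ipV x y = 3) : ∃ w : WE8, w.1 x = y := by
  have hα : x - y ∈ Delta := by
    refine ⟨sub_mem_P hx hy, ?_⟩
    simp only [map_sub, LinearMap.sub_apply, hxx, hyy, hxy, ipV_comm y x]
    norm_num
  refine ⟨⟨_, reflV_mem_WE8 hα⟩, ?_⟩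
  rw [reflV_apply, map_sub, LinearMap.sub_apply, hxx, ipV_comm y x, hxy]
  module

/-- An integral vector all of whose length is carried by one coordinate. -/
theorem eq_smul_single_of_sq_eq {x : V} {m : Fin 8 → ℤ} (hm : ∀ j, x j = m j) {q : ℤ}
    (hx : ∑ j, m j ^ 2 = q ^ 2) {i : Fin 8} (hi : m i ^ 2 = q ^ 2) :
    x = (q : ℂ) • Pi.single i 1 ∨ x = -((q : ℂ) • Pi.single i 1) := by
  have h0 (j : Fin 8) (hj : j ≠ i) : m j = 0 := by
    rw [← Finset.add_sum_erase _ _ (Finset.mem_univ i), hi, add_eq_left,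
      Finset.sum_eq_zero_iff_of_nonneg fun j _ => sq_nonneg _] at hx
    exact pow_eq_zero_iff two_ne_zero |>.1 (hx j (by simp [hj]))
  rcases sq_eq_sq_iff_eq_or_eq_neg.1 hi with h | h
  · refine Or.inl (funext fun j => ?_)
    by_cases hj : j = i
    · subst hj; simp [hm, h]
    · simp [hm, h0 j hj, hj]
  · refine Or.inr (funext fun j => ?_)
    by_cases hj : j = i
    · subst hj; simp [hm, h]
    · simp [hm, h0 j hj, hj]

theorem sum_sq_eq_of_int {x : V} {m : Fin 8 → ℤ} (hm : ∀ j, x j = m j) {n : ℤ}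
    (hx : ipV x x = n) : ∑ j, m j ^ 2 = n := by
  have : ((∑ j, m j ^ 2 : ℤ) : ℂ) = n := by
    rw [← hx, ipV_apply]
    push_cast
    exact Finset.sum_congr rfl fun j _ => by rw [hm]; ring
  exact_mod_cast this

theorem sum_sq_eq_of_half {x : V} {m : Fin 8 → ℤ} (hm : ∀ j, x j = phi j + m j) {n : ℤ}
    (hx : ipV x x = n) : ∑ j, (2 * m j + 1) ^ 2 = 4 * n := by
  have : ((∑ j, (2 * m j + 1) ^ 2 : ℤ) : ℂ) = (4 * n : ℤ) := by
    push_cast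
    rw [← hx, ipV_apply, Finset.mul_sum]
    exact Finset.sum_congr rfl fun j _ => by rw [hm, phi_apply]; ring
  exact_mod_cast this

/-- A half-integral vector of norm `4` in `P` has a coordinate `±3/2`, so it is conjugate to
`±2v_i` by a single reflection. -/
theorem exists_WE8_apply_eq_two_single_of_half {x : V} (hx : x ∈ P) (hxx : ipV x x = 4)
    (h : ∀ j, ∃ n : ℤ, x j = phi j + n) :
    ∃ (w : WE8) (i : Fin 8), w.1 x = (2 : ℂ) • Pi.single i 1 ∨
      w.1 x = -((2 : ℂ) • Pi.single i 1) := by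
  choose m hm using h
  have hs : ∑ j, (2 * m j + 1) ^ 2 = 4 * 4 := sum_sq_eq_of_half hm (by rw [hxx]; norm_num)
  have hex : ∃ i, m i ≠ 0 ∧ m i ≠ -1 := by
    by_contra! hc
    have h1 (j : Fin 8) : (2 * m j + 1) ^ 2 = 1 := by
      by_cases h0 : m j = 0
      · rw [h0]; norm_num
      · rw [hc j h0]; norm_num
    simp [h1] at hs
  obtain ⟨i, hi0, hi1⟩ := hex
  have hle : (2 * m i + 1) ^ 2 ≤ 16 :=
    (Finset.single_le_sum (f := fun j => (2 * m j + 1) ^ 2) (fun j _ => sq_nonneg _)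
      (Finset.mem_univ i)).trans_eq (hs.trans (by norm_num))
  have hB : ipV (Pi.single i 1) (Pi.single i 1) = 1 := by rw [ipV_single]; simp
  have h12 : m i = 1 ∨ m i = -2 := by
    have h2 : m i < 2 := by nlinarith
    have h3 : -3 < m i := by nlinarith
    omega
  rcases h12 with h | h
  · obtain ⟨w, hw⟩ := exists_WE8_apply_eq hx (two_smul_single_mem_P i) hxx
      (by simp only [map_smul, LinearMap.smul_apply, hB, smul_eq_mul]; norm_num)
      (by rw [map_smul, ipV_comm, ipV_single, hm, h, phi_apply]; norm_num)
    exact ⟨w, i, Or.inl hw⟩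
  · obtain ⟨w, hw⟩ := exists_WE8_apply_eq hx (neg_mem_P (two_smul_single_mem_P i)) hxx
      (by simp only [map_neg, LinearMap.neg_apply, map_smul, LinearMap.smul_apply, hB,
            smul_eq_mul]; norm_num)
      (by rw [map_neg, map_smul, ipV_comm, ipV_single, hm, h, phi_apply]; norm_num)
    exact ⟨w, i, Or.inr hw⟩

/-- Every vector of norm `4` in `P` is conjugate to some `±2v_i`. The vectors
`(±1^4, 0^4)` are reflected to half-integral ones. -/
theorem exists_WE8_apply_eq_two_single {x : V} (hx : x ∈ P) (hxx : ipV x x = 4) :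
    ∃ (w : WE8) (i : Fin 8), w.1 x = (2 : ℂ) • Pi.single i 1 ∨
      w.1 x = -((2 : ℂ) • Pi.single i 1) := by
  obtain ⟨h | h, N, hN⟩ := id hx
  swap
  · exact exists_WE8_apply_eq_two_single_of_half hx hxx h
  choose m hm using h
  have hs : ∑ j, m j ^ 2 = 4 := sum_sq_eq_of_int hm (by rw [hxx]; norm_num)
  by_cases h2 : ∃ i, m i ^ 2 = 2 ^ 2
  · obtain ⟨i, hi⟩ := h2
    exact ⟨1, i, by simpa using eq_smul_single_of_sq_eq hm (by rw [hs]; norm_num) hi⟩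
  push Not at h2
  have hm1 (k : Fin 8) : m k = 0 ∨ m k = 1 ∨ m k = -1 := by
    have hle : m k ^ 2 ≤ 4 :=
      (Finset.single_le_sum (f := fun j => m j ^ 2) (fun j _ => sq_nonneg _)
        (Finset.mem_univ k)).trans_eq hs
    have h3 : m k < 3 := by nlinarith
    have h4 : -3 < m k := by nlinarith
    have h5 : m k ≠ 2 := fun h => h2 k (by rw [h])
    have h6 : m k ≠ -2 := fun h => h2 k (by rw [h]; norm_num)
    omega
  obtain ⟨i, hi⟩ : ∃ i, m i ≠ 0 := by
    by_contra! hc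
    simp [hc] at hs
  obtain ⟨j, hj⟩ : ∃ j, m j = 0 := by
    by_contra! hc
    have h1 (k : Fin 8) : m k ^ 2 = 1 := by rcases hm1 k with h | h | h <;> simp_all
    simp [h1] at hs
  have hij : i ≠ j := fun h => hi (h ▸ hj)
  have hi2 : x i ^ 2 = 1 := by rw [hm]; rcases hm1 i with h | h | h <;> simp_all
  have hxj : x j = 0 := by rw [hm, hj]; simp
  -- The half-integral vector `y` agrees with `x / 2` on the support of `x`, except that the
  -- coordinate `x_i` is `3 x_i / 2`; off the support its coordinates are `1/2`, except that the
  -- sign of the `j`-th one (given by `u`) is adjusted to make `⟨φ, y⟩` integral.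
  obtain ⟨u, K, hu, hK⟩ : ∃ u K : ℤ, u ^ 2 = u ∧ N + m i + 2 - u = 2 * K := by
    rcases Int.even_or_odd' (N + m i) with ⟨k, hk | hk⟩
    · exact ⟨0, k + 1, by norm_num, by omega⟩
    · exact ⟨1, k + 1, by norm_num, by omega⟩
  have hu' : (u : ℂ) ^ 2 = u := by exact_mod_cast hu
  have hK' : (N : ℂ) + x i + 2 - u = 2 * K := by rw [hm]; exact_mod_cast hK
  set C : V := fun k => 1 - x k ^ 2 with hC
  have hx3 (k : Fin 8) : x k ^ 3 = x k := by
    rw [hm]; rcases hm1 k with h | h | h <;> rw [h] <;> norm_num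
  have hsumsq : ∑ k, x k ^ 2 = 4 := by
    rw [← hxx, ipV_apply]
    exact Finset.sum_congr rfl fun k _ => sq _
  have hxC : ipV x C = 0 := by
    rw [ipV_apply]
    exact Finset.sum_eq_zero fun k _ => by linear_combination -hx3 k
  have hCC : ipV C C = 4 := by
    have : ipV C C = ∑ k, (1 - x k ^ 2) := by
      rw [ipV_apply]
      exact Finset.sum_congr rfl fun k _ => by linear_combination x k * hx3 k
    rw [this, Finset.sum_sub_distrib, hsumsq]
    simp; norm_num
  have hφC : ipV phi C = 2 := by
    have : ipV phi C = 1 / 2 * ∑ k, (1 - x k ^ 2) := by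
      rw [ipV_apply, Finset.mul_sum]
      rfl
    rw [this, Finset.sum_sub_distrib, hsumsq]
    simp; norm_num
  set Bi : V := Pi.single i 1 with hBi
  set Bj : V := Pi.single j 1 with hBj
  have hBiBi : ipV Bi Bi = 1 := by rw [hBi, ipV_single]; simp
  have hBjBj : ipV Bj Bj = 1 := by rw [hBj, ipV_single]; simp
  have hBiBj : ipV Bi Bj = 0 := by rw [hBi, ipV_single, hBj]; simp [hij]
  have hxBi : ipV x Bi = x i := by rw [ipV_comm, ipV_single]
  have hxBj : ipV x Bj = 0 := by rw [ipV_comm, ipV_single, hxj]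
  have hBiC : ipV Bi C = 0 := by rw [ipV_single, hC]; linear_combination -hi2
  have hBjC : ipV Bj C = 1 := by rw [ipV_single, hC]; simp [hxj]
  set y : V := (1 / 2 : ℂ) • (x + C) + x i • Bi - (u : ℂ) • Bj with hy
  have hyhalf (k : Fin 8) : ∃ n : ℤ, y k = phi k + n := by
    refine ⟨(if m k = 1 then 0 else -m k ^ 2) + m i * (Pi.single i 1 : Fin 8 → ℤ) k -
      u * (Pi.single j 1 : Fin 8 → ℤ) k, ?_⟩
    have h1 (i : Fin 8) : (((Pi.single i 1 : Fin 8 → ℤ) k : ℤ) : ℂ) = (Pi.single i 1 : V) k := by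
      by_cases h : k = i
      · subst h; simp
      · simp [h]
    push_cast
    rw [h1, h1, hy, hBi, hBj]
    simp only [Pi.sub_apply, Pi.add_apply, Pi.smul_apply, smul_eq_mul, hC, phi_apply, hm]
    rcases hm1 k with h | h | h <;> simp [h] <;> ring
  have hyP : y ∈ P := by
    refine ⟨Or.inr hyhalf, K, ?_⟩
    have h1 (k : Fin 8) : ipV phi (Pi.single k 1) = 1 / 2 := by rw [ipV_comm, ipV_single]; rfl
    rw [hy]
    simp only [map_add, map_sub, map_smul, hN, hφC, hBi, hBj, h1, smul_eq_mul]
    linear_combination hK' / 2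
  have hyy : ipV y y = 4 := by
    rw [hy]
    simp only [map_add, map_sub, map_smul, LinearMap.add_apply, LinearMap.sub_apply,
      LinearMap.smul_apply, hxx, hxC, hCC, hBiBi, hBjBj, hBiBj, hxBi, hxBj, hBiC, hBjC,
      ipV_comm C x, ipV_comm Bi x, ipV_comm Bj x, ipV_comm C Bi, ipV_comm C Bj, ipV_comm Bj Bi,
      smul_eq_mul]
    linear_combination 2 * hi2 + hu'
  have hxy : ipV x y = 3 := by
    rw [hy]
    simp only [map_add, map_sub, map_smul, hxx, hxC, hxBi, hxBj, smul_eq_mul]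
    linear_combination hi2
  obtain ⟨w, hw⟩ := exists_WE8_apply_eq hx hyP hxx hyy hxy
  obtain ⟨w', k, hw'⟩ := exists_WE8_apply_eq_two_single_of_half hyP hyy hyhalf
  exact ⟨w' * w, k, by rw [← hw] at hw'; exact hw'⟩

/-- A unit vector congruent to `±v_i` modulo `P` is some `±v_j`: it is integral, because
half-integral vectors have norm at least `2`. -/
theorem eq_single_of_add_mem_P {a b : V} {i : Fin 8}
    (ha : a = Pi.single i 1 ∨ a = -Pi.single i 1) (hbb : ipV b b = 1) (hab : a + b ∈ P) :
    ∃ j : Fin 8, b = Pi.single j 1 ∨ b = -Pi.single j 1 := by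
  have haZ : ∀ k, ∃ n : ℤ, a k = n := by
    intro k
    by_cases hk : k = i
    · subst hk
      rcases ha with rfl | rfl
      · exact ⟨1, by simp⟩
      · exact ⟨-1, by simp⟩
    · exact ⟨0, by rcases ha with rfl | rfl <;> simp [hk]⟩
  choose r hr using haZ
  obtain ⟨h | h, -⟩ := hab <;> choose m hm using h
  · have hb (k : Fin 8) : b k = (m k - r k : ℤ) := by
      have := hm k
      rw [Pi.add_apply, hr] at this
      push_cast
      linear_combination this
    have hs : ∑ k, (m k - r k) ^ 2 = 1 := sum_sq_eq_of_int hb (by rw [hbb]; norm_num)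
    obtain ⟨j, hj⟩ : ∃ j, m j - r j ≠ 0 := by
      by_contra! hc
      simp [hc] at hs
    have hle : (m j - r j) ^ 2 ≤ 1 :=
      (Finset.single_le_sum (f := fun j => (m j - r j) ^ 2) (fun j _ => sq_nonneg _)
        (Finset.mem_univ j)).trans_eq hs
    have hpos : 0 < (m j - r j) ^ 2 := by positivity
    have := eq_smul_single_of_sq_eq hb (q := 1) (by rw [hs]; norm_num)
      (i := j) (by rw [one_pow]; omega)
    exact ⟨j, by simpa using this⟩
  · exfalso
    have hb (k : Fin 8) : b k = phi k + (m k - r k : ℤ) := by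
      have := hm k
      rw [Pi.add_apply, hr] at this
      push_cast
      linear_combination this
    have hs : ∑ k, (2 * (m k - r k) + 1) ^ 2 = 4 * 1 :=
      sum_sq_eq_of_half hb (by rw [hbb]; norm_num)
    have h1 (k : Fin 8) : 1 ≤ (2 * (m k - r k) + 1) ^ 2 := by
      have : 2 * (m k - r k) + 1 ≠ 0 := by omega
      have : 0 < (2 * (m k - r k) + 1) ^ 2 := by positivity
      omega
    have := Finset.sum_le_sum fun k (_ : k ∈ Finset.univ) => h1 k
    rw [hs] at this
    simp at this

theorem exists_frameVec_eq (r : Fin 8) :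
    ∃ i : Fin 9, i ≠ 8 ∧ ((Pi.single r 1 : V) = frameVec i 8 ∨
      (Pi.single r 1 : V) = -frameVec i 8) := by
  have hv (r : Fin 8) : proj (v r) = Pi.single r 1 := by
    ext j
    rw [proj_apply, ipH_v_v, Pi.single_apply]
  have hf (i : Fin 9) : proj (vAux i) = frameVec i 8 := by
    rw [vAux, map_add, map_smul, proj_c, smul_zero, add_zero, frameVec]
  induction r using Fin.cases with
  | zero =>
    refine ⟨7, by decide, Or.inr ?_⟩
    rw [← hv, ← hf]
    simp [v]
  | succ j =>
    refine ⟨j.castSucc.castSucc, fun h => ?_, Or.inl ?_⟩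
    · have := congrArg Fin.val h
      simp at this
      omega
    · rw [← hv, ← hf]
      simp [v]

/-- Every `C_3`-frame is conjugate, up to signs, to a frame of the bilinear equations with
`l = 9`. -/
theorem IsC3Frame.exists_WE8 {a b c : V} (h : IsC3Frame a b c) :
    ∃ (w : WE8) (i j k : Fin 9), i ≠ j ∧ i ≠ k ∧ j ≠ k ∧ i ≠ 8 ∧ j ≠ 8 ∧ k ≠ 8 ∧
      (w.1 a = frameVec i 8 ∨ w.1 a = -frameVec i 8) ∧
      (w.1 b = frameVec j 8 ∨ w.1 b = -frameVec j 8) ∧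
      (w.1 c = frameVec k 8 ∨ w.1 c = -frameVec k 8) := by
  obtain ⟨w, i, hi⟩ := exists_WE8_apply_eq_two_single h.two_a
    (by simp only [map_smul, LinearMap.smul_apply, h.aa, smul_eq_mul]; norm_num)
  have hw := h.map w
  have ha : w.1 a = Pi.single i 1 ∨ w.1 a = -Pi.single i 1 := by
    have hinj : Function.Injective ((2 : ℂ) • · : V → V) := smul_right_injective V two_ne_zero
    rw [map_smul, ← smul_neg] at hi
    exact hi.imp (fun h => hinj h) (fun h => hinj h)
  obtain ⟨j, hj⟩ := eq_single_of_add_mem_P ha hw.bb hw.ab_add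
  obtain ⟨k, hk⟩ := eq_single_of_add_mem_P ha hw.cc (by rw [add_comm]; exact hw.ca_add)
  have key {x : V} {r : Fin 8} (hx : x = Pi.single r 1 ∨ x = -Pi.single r 1) :
      ∃ i : Fin 9, i ≠ 8 ∧ (x = frameVec i 8 ∨ x = -frameVec i 8) := by
    obtain ⟨i, hi, h⟩ := exists_frameVec_eq r
    refine ⟨i, hi, ?_⟩
    rcases hx with rfl | rfl <;> rcases h with h | h <;> simp [h]
  have hne {x y : V} (hxy : ipV x y = 0) {i j : Fin 9} (hi : i ≠ 8)
      (hx : x = frameVec i 8 ∨ x = -frameVec i 8) (hy : y = frameVec j 8 ∨ y = -frameVec j 8) :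
      i ≠ j := by
    rintro rfl
    rcases hx with rfl | rfl <;> rcases hy with rfl | rfl <;>
      simp [ipV_frameVec i i 8 hi hi] at hxy
  obtain ⟨i', hi', ha'⟩ := key ha
  obtain ⟨j', hj', hb'⟩ := key hj
  obtain ⟨k', hk', hc'⟩ := key hk
  exact ⟨w, i', j', k', hne hw.ab hi' ha' hb', (hne hw.ca hk' hc' ha').symm,
    hne hw.bc hj' hb' hc', hi', hj', hk', ha', hb', hc'⟩

/-! ### From lattice `τ`-functions to ORG `τ`-functions -/

theorem isORGOn_of_isLatticeTau {X : Type*} [MulAction Wext X] {br : ℂ → ℂ} (hbr : IsBracket br)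
    {γ : X → Hbar} (hγ : ∀ (g : Wext) (x : X), γ (g • x) = actBar g (γ x)) {U : Set X}
    (hU : ∀ (a : V) (ha : (2 : ℂ) • a ∈ P), a ∈ P → ∀ x ∈ U, transl a ha • x ∈ U)
    {τ : X → ℂ} (h : IsLatticeTau br (fun y : Cover X => γ y.pt) (coverSet U)
      (fun Λ y => coverFun τ (translM Λ • y))) : IsORGOn br γ U τ := by
  intro a b c hF x hx
  obtain ⟨w, i, j, k, hij, hik, hjk, hi, hj, hk, ha, hb, hc⟩ := hF.exists_WE8
  have hm := two_smul_midVec_mem_P 8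
  -- The point `y` is chosen so that `w⁻¹.T_{midVec}.y = x`.
  set y : X := (transl (midVec 8) hm)⁻¹ • emb w • x with hy
  have hxy : x = (emb w)⁻¹ • transl (midVec 8) hm • y := by
    rw [hy, smul_inv_smul, inv_smul_smul]
  have hinv {a f : V} (h : w.1 a = f ∨ w.1 a = -f) :
      a = (w⁻¹ : WE8).1 f ∨ a = -(w⁻¹ : WE8).1 f := by
    rcases h with h | h
    · exact Or.inl (by rw [← h, WE8_apply_inv_apply])
    · exact Or.inr (by rw [← map_neg, ← h, WE8_apply_inv_apply])
  have hmem : (⟨w, y⟩ : Cover X) ∈ coverSet U := by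
    have hP : w.1 a - midVec 8 ∈ P := by
      rcases ha with ha | ha
      · rw [ha, ← neg_sub, midVec_sub_frameVec i 8 hi]
        exact neg_mem_P (proj_sub_e_nine_mem_P _)
      · rw [ha, ← neg_add', frameVec_add_midVec]
        exact neg_mem_P (proj_sub_e_nine_mem_P _)
    have hP' := WE8_mem_P w⁻¹.2 hP
    refine ⟨_, hU _ (two_smul_mem_P hP') hP' _ hx, ?_⟩
    have hn : (2 : ℂ) • (-midVec 8) ∈ P := by rw [smul_neg]; exact neg_mem_P hm
    have hwn := two_smul_WE8_mem_P w⁻¹ hn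
    change y = emb w • _
    rw [← inv_smul_eq_iff, hy, transl_inv _ hm hn, emb_inv_transl_smul w _ hn hwn, inv_smul_smul]
    conv_lhs => rw [← smul_inv_smul (transl a hF.two_a) x]
    refine transl_smul_smul ?_ _ _ _ _
    rw [map_sub, WE8_apply_inv_apply, map_neg]
    abel
  have h0 := h.bilinear i j k 8 hij hik hi hjk hj hk _ hmem
  have h1 := lattice_expr_eq hbr hγ τ hi hj hk w y x hxy hF.two_a hF.two_b hF.two_c
    (hinv ha) (hinv hb) (hinv hc)
  exact neg_eq_zero.1 (h1.symm.trans h0)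

/-! ### Functions on `V` as functions on `𝔥` -/

theorem proj_transl_smul (a : V) (ha : (2 : ℂ) • a ∈ P) (h : H) :
    proj (transl a ha • h) = proj h + ipH c h • a := by
  change proj (kac (iota0 a) h) = _
  rw [kac_iota0_apply]
  simp only [map_add, map_sub, map_smul, proj_iota, proj_c, smul_zero, sub_zero]

theorem proj_transl_inv_smul (a : V) (ha : (2 : ℂ) • a ∈ P) (h : H) :
    proj ((transl a ha)⁻¹ • h) = proj h - ipH c h • a := by
  rw [transl_inv a ha (by rw [smul_neg]; exact neg_mem_P ha), proj_transl_smul, smul_neg,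
    sub_eq_add_neg]

theorem ipH_c_smul (g : Wext) (h : H) : ipH c (g • h) = ipH c h := (Wext_le_Stab g.2).2 h

theorem proj_emb_smul (w : WE8) (h : H) : proj (emb w • h) = w.1 (proj h) := by
  change proj (ext w.1 h) = _
  rw [ext_apply]
  simp only [map_add, map_sub, proj_iota, sub_self, add_zero]

theorem IsORG.isORGOn {br : ℂ → ℂ} {κ : ℂ} {D : Set V} (hDP : ∀ a ∈ P, ∀ x ∈ D, x + κ • a ∈ D)
    {τ : V → ℂ} (hτ : IsORG br κ D τ) :
    IsORGOn br (fun h : H => Submodule.Quotient.mk h) {h : H | ipH c h = κ ∧ proj h ∈ D}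
      (fun h => τ (proj h)) := by
  rintro a b c' hF h ⟨hκ, hD⟩
  rw [ipH_c_smul] at hκ
  rw [proj_transl_inv_smul, hκ] at hD
  have hD' : proj h + κ • a ∈ D := by
    convert hDP _ hF.two_a _ hD using 1
    module
  have := hτ a b c' hF _ hD'
  simp only [sigma, pairBar_mk, iota0_coe, ipH_iota_left, proj_transl_smul, proj_transl_inv_smul,
    hκ]
  linear_combination this

/-- On the part of `𝔥` of level `κ`, the function `T_{Λ - e_9}⁻¹.τ̃` is the translate of `τ` by
`κπ(Λ - e_9)`. -/
theorem coverFun_proj {κ : ℂ} (τ : V → ℂ) (Λ : M) {y : Cover H} (hy : ipH c y.pt = κ) :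
    coverFun (fun h : H => τ (proj h)) (translM Λ • y) =
      τ ((y.w⁻¹ : WE8).1 (proj y.pt + κ • proj ((Λ : H) - e 9))) := by
  obtain ⟨w, h⟩ := y
  rw [translM_eq Λ (two_smul_mem_P (proj_sub_e_nine_mem_P Λ)), coverFun_transl_smul, ← emb_inv,
    proj_emb_smul, proj_transl_smul, hy]

theorem IsLatticeTau.congr {Y : Type*} [MulAction Waff Y] {br : ℂ → ℂ} {γ : Y → Hbar} {S : Set Y}
    {τ τ' : M → Y → ℂ} (h : IsLatticeTau br γ S τ) (hτ : ∀ Λ, ∀ y ∈ S, τ Λ y = τ' Λ y) :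
    IsLatticeTau br γ S τ' where
  stable := h.stable
  equivariant w Λ y hy := by
    rw [← hτ _ _ (h.stable w⁻¹ y hy), ← hτ _ _ hy, h.equivariant w Λ y hy]
  bilinear i j k l hij hik hil hjk hjl hkl y hy := by
    simp only [← hτ _ _ hy]
    exact h.bilinear i j k l hij hik hil hjk hjl hkl y hy

end E8Tau

open E8Tau in
theorem mainTheorem8 (br : ℂ → ℂ) (hbr : IsBracket br) :
    -- the characterization of ORG tau-functions through lattice tau-functions on the covering space
    (∀ (X : Type*) [MulAction Wext X] (γ : X → Hbar)
        (_hγ : ∀ (g : Wext) (x : X), γ (g • x) = actBar g (γ x))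
        (U : Set X)
        (_hU : ∀ (a : V) (ha : (2 : ℂ) • a ∈ P), a ∈ P → ∀ x ∈ U, transl a ha • x ∈ U)
        (τ : X → ℂ),
        IsORGOn br γ U τ ↔
          IsLatticeTau br (fun y : Cover X => γ y.pt) (coverSet U)
            (fun Λ y => coverFun τ (translM Λ • y))) ∧
    -- lattice tau-functions from an ORG tau-function on a subset `D` of `V`
    (∀ (κ : ℂ) (_hκ : κ ≠ 0) (_hκ' : ∀ n : ℤ, n ≠ 0 → br (n * κ) ≠ 0)
        (D : Set V)
        (_hDW : ∀ w ∈ WE8, ∀ x ∈ D, w x ∈ D)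
        (_hDP : ∀ a ∈ P, ∀ x ∈ D, x + κ • a ∈ D)
        (τ : V → ℂ) (_hτ : IsORG br κ D τ),
        IsLatticeTau br (fun y : Cover H => Submodule.Quotient.mk y.pt)
          (coverSet {h : H | ipH c h = κ ∧ proj h ∈ D})
          (fun (Λ : M) (y : Cover H) =>
            τ ((y.w⁻¹ : WE8).1 (proj y.pt + κ • proj ((Λ : H) - e 9))))) := by
  refine ⟨fun X _ γ hγ U hU τ => ⟨isLatticeTau_of_isORGOn hbr hγ hU,
    isORGOn_of_isLatticeTau hbr hγ hU⟩, fun κ _ _ D _ hDP τ hτ => ?_⟩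
  refine (isLatticeTau_of_isORGOn hbr (fun _ _ => rfl) ?_ (hτ.isORGOn hDP)).congr ?_
  · rintro a ha haP h ⟨hκ, hD⟩
    refine ⟨by rw [ipH_c_smul, hκ], ?_⟩
    rw [proj_transl_smul, hκ]
    exact hDP a haP _ hD
  · rintro Λ y ⟨u, ⟨hκ, -⟩, hu⟩
    exact coverFun_proj τ Λ (by rw [hu, ipH_c_smul, hκ])
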